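/- Let $\mathsf k$ be a field, let $S=\mathsf k[x_1,\dots,x_n]$ with the standard grading $\deg x_i=1$, and let $I\subseteq S$ be a nonzero monomial complete intersection ideal, i.e. a nonzero ideal generated by monomials that form a regular sequence in $S$ (equivalently, by pairwise coprime monomials different from $1$). Let $\bar I$ be the integral closure of $I$, i.e. the ideal of all $x\in S$ that satisfy an equation $x^m+a_1x^{m-1}+\cdots+a_m=0$ with $m\ge 1$ and $a_i\in I^i$ for all $i$. For a nonzero homogeneous ideal $J\subseteq S$ let $$\operatorname{reg}(J)=\max\{\,j-i \mid \operatorname{Tor}_i^S(J,\mathsf k)_j\neq 0\,\}$$ be its Castelnuovo–Mumford regularity. Then $$\operatorname{reg}(\bar I)\le \operatorname{reg}(I).$$ -/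

import Mathlib

/-! ### Integral closure of an ideal -/

/-- The element `x` is integral over the ideal `I`: it satisfies an equation
`x ^ m + a₁ x ^ (m - 1) + ⋯ + aₘ = 0` with `m ≥ 1` and `aᵢ ∈ I ^ i`. -/
def IsIntegralOverIdeal {R : Type*} [CommRing R] (I : Ideal R) (x : R) : Prop :=
  ∃ m : ℕ, 1 ≤ m ∧ ∃ a : ℕ → R, (∀ i ∈ Finset.Icc 1 m, a i ∈ I ^ i) ∧
    x ^ m + ∑ i ∈ Finset.Icc 1 m, a i * x ^ (m - i) = 0

/-- `x` is integral over `I` iff `x t` is integral over the Rees algebra `R[I t]`. It is used only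
to see that the elements integral over `I` form an ideal. -/
theorem isIntegralOverIdeal_iff_rees {R : Type*} [CommRing R] (I : Ideal R) (x : R) :
    IsIntegralOverIdeal I x ↔
      IsIntegral (reesAlgebra I) (Polynomial.monomial 1 x : Polynomial R) := by
  constructor
  · rintro ⟨m, hm, a, ha, h⟩
    let b : ℕ → reesAlgebra I := fun i =>
      if hi : i ∈ Finset.Icc 1 m then
        ⟨Polynomial.monomial i (a i), reesAlgebra.monomial_mem.2 (ha i hi)⟩ else 0
    have hb : ∀ i ∈ Finset.Icc 1 m, algebraMap (reesAlgebra I) (Polynomial R) (b i) =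
        Polynomial.monomial i (a i) := by
      intro i hi
      simp only [b, dif_pos hi]
      rfl
    refine ⟨Polynomial.X ^ m + ∑ i ∈ Finset.Icc 1 m,
      Polynomial.C (b i) * Polynomial.X ^ (m - i), ?_, ?_⟩
    · refine Polynomial.monic_X_pow_add (Polynomial.mem_degreeLT.1 (Submodule.sum_mem _ ?_))
      intro i hi
      refine Polynomial.mem_degreeLT.2 ?_
      refine lt_of_le_of_lt (Polynomial.degree_C_mul_X_pow_le _ _) ?_
      have := Finset.mem_Icc.1 hi
      exact_mod_cast (by omega : m - i < m)
    · have key : ∀ i ∈ Finset.Icc 1 m, algebraMap (reesAlgebra I) (Polynomial R) (b i) *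
          (Polynomial.monomial 1 x) ^ (m - i) = Polynomial.monomial m (a i * x ^ (m - i)) := by
        intro i hi
        have := Finset.mem_Icc.1 hi
        have e : i + 1 * (m - i) = m := by omega
        rw [hb i hi, Polynomial.monomial_pow, Polynomial.monomial_mul_monomial, e]
      simp only [Polynomial.eval₂_add, Polynomial.eval₂_pow, Polynomial.eval₂_X,
        Polynomial.eval₂_finsetSum, Polynomial.eval₂_mul, Polynomial.eval₂_C]
      rw [Finset.sum_congr rfl key, Polynomial.monomial_pow, one_mul, ← map_sum, ← map_add, h,
        map_zero]
  · rintro ⟨p, hp, h⟩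
    by_cases hd : p.natDegree = 0
    · rw [hp.natDegree_eq_zero.1 hd] at h
      have h0 : (1 : R) = 0 := by
        have := congrArg (Polynomial.coeff · 0) h
        simpa using this
      exact ⟨1, le_rfl, fun _ => 0, by simp, by
        rw [← mul_one (x ^ 1 + _), h0, mul_zero]⟩
    · set m := p.natDegree with hm
      refine ⟨m, Nat.one_le_iff_ne_zero.2 hd,
        fun i => ((p.coeff (m - i) : reesAlgebra I) : Polynomial R).coeff i, ?_, ?_⟩
      · intro i _
        exact (p.coeff (m - i)).2 i
      · rw [Polynomial.eval₂_eq_sum_range, ← hm, Finset.sum_range_succ] at h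
        have h1 := congrArg (Polynomial.coeff · m) h
        have hc : p.coeff m = 1 := hp.coeff_natDegree
        simp only [hc, map_one, one_mul, Polynomial.monomial_pow, Polynomial.coeff_add,
          Polynomial.coeff_monomial, if_true, Polynomial.finsetSum_coeff,
          Polynomial.coeff_zero] at h1
        rw [add_comm, ← h1]
        congr 1
        refine (Finset.sum_bij' (fun i _ => m - i) (fun i _ => m - i) ?_ ?_ ?_ ?_ ?_)
        · intro i hi
          have := Finset.mem_Icc.1 hi
          exact Finset.mem_range.2 (by omega)
        · intro i hi
          have := Finset.mem_range.1 hi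
          exact Finset.mem_Icc.2 ⟨by omega, by omega⟩
        · intro i hi
          have := Finset.mem_Icc.1 hi
          omega
        · intro i hi
          have := Finset.mem_range.1 hi
          omega
        · intro i hi
          have := Finset.mem_Icc.1 hi
          have e : m = i + (m - i) := by omega
          conv_rhs => rw [e]
          rw [show i + (m - i) - i = m - i by omega]
          rw [Polynomial.coeff_mul_monomial]
          rfl

/-- The integral closure of the ideal `I`: the ideal of all elements integral over `I`. -/
def idealIntegralClosure {R : Type*} [CommRing R] (I : Ideal R) : Ideal R where
  carrier := {x | IsIntegralOverIdeal I x}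
  zero_mem' := by
    rw [Set.mem_ofPred_eq, isIntegralOverIdeal_iff_rees, map_zero]
    exact isIntegral_zero
  add_mem' := by
    intro x y hx hy
    rw [Set.mem_ofPred_eq, isIntegralOverIdeal_iff_rees] at hx hy ⊢
    rw [map_add]
    exact hx.add hy
  smul_mem' := by
    intro c x hx
    rw [Set.mem_ofPred_eq, isIntegralOverIdeal_iff_rees] at hx ⊢
    have : (Polynomial.monomial 1 (c • x) : Polynomial R) =
        algebraMap (reesAlgebra I) (Polynomial R) (algebraMap R _ c) *
          Polynomial.monomial 1 x := by
      rw [← IsScalarTower.algebraMap_apply R (reesAlgebra I) (Polynomial R),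
        Polynomial.algebraMap_eq, Polynomial.C_mul_monomial, smul_eq_mul]
    rw [this]
    exact (isIntegral_algebraMap).mul hx

/-! ### Graded Tor, graded Betti numbers and regularity -/

/-- The sign `(-1) ^ #{s ∈ T : s < t}` with which `e_t` moves to its place in the exterior
monomial `e_{T ∪ {t}}`. -/
def koszulSign {n : ℕ} (T : Finset (Fin n)) (t : Fin n) : ℤ :=
  (-1) ^ (T.filter (· < t)).card

/-- The differential of the Koszul complex `M ⊗ K(x₁, …, xₙ)`. An element `∑_T m(T) e_T`, where
`T` runs over the subsets of the set of variables and `e_T` has homological degree `#T`, is given by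
its coefficients `m(T)`; the differential is
`m e_U ↦ ∑_{t ∈ U} (-1) ^ #{s ∈ U : s < t} x_t m e_{U \ {t}}`. -/
noncomputable def koszulDiff (k : Type*) [Field k] {n : ℕ} {M : Type*} [AddCommGroup M]
    [Module (MvPolynomial (Fin n) k) M] :
    (Finset (Fin n) → M) →ₗ[MvPolynomial (Fin n) k] (Finset (Fin n) → M) where
  toFun m T := ∑ t ∈ Tᶜ, koszulSign T t • (MvPolynomial.X t : MvPolynomial (Fin n) k) •
    m (insert t T)
  map_add' m m' := by
    ext T
    simp [Finset.sum_add_distrib]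
  map_smul' c m := by
    ext T
    simp only [Pi.smul_apply, RingHom.id_apply, Finset.smul_sum]
    refine Finset.sum_congr rfl fun t _ => ?_
    rw [smul_comm (MvPolynomial.X t) c, smul_comm _ c]

theorem koszulDiff_apply {k : Type*} [Field k] {n : ℕ} {M : Type*} [AddCommGroup M]
    [Module (MvPolynomial (Fin n) k) M] (m : Finset (Fin n) → M) (T : Finset (Fin n)) :
    koszulDiff k m T = ∑ t ∈ Tᶜ,
      koszulSign T t • (MvPolynomial.X t : MvPolynomial (Fin n) k) • m (insert t T) := rfl

theorem koszulSign_insert_of_lt {n : ℕ} {T : Finset (Fin n)} {s t : Fin n} (hs : s ∉ T)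
    (h : s < t) : koszulSign (insert s T) t = -koszulSign T t := by
  unfold koszulSign
  rw [Finset.filter_insert, if_pos h, Finset.card_insert_of_notMem (by simp [hs]), pow_succ]
  ring

theorem koszulSign_insert_of_gt {n : ℕ} {T : Finset (Fin n)} {s t : Fin n}
    (h : t < s) : koszulSign (insert s T) t = koszulSign T t := by
  unfold koszulSign
  rw [Finset.filter_insert, if_neg (not_lt.2 h.le)]

/-- `M ⊗ K(x₁, …, xₙ)` is a complex. -/
theorem koszulDiff_comp_self {k : Type*} [Field k] {n : ℕ} {M : Type*} [AddCommGroup M]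
    [Module (MvPolynomial (Fin n) k) M] (m : Finset (Fin n) → M) :
    koszulDiff k (koszulDiff k m) = 0 := by
  ext T
  simp only [koszulDiff_apply, Finset.smul_sum, Pi.zero_apply]
  rw [Finset.sum_sigma']
  refine Finset.sum_involution (fun p _ => ⟨p.2, p.1⟩) ?_ ?_ ?_ ?_
  · rintro ⟨t, u⟩ h
    simp only [Finset.mem_sigma, Finset.mem_compl, Finset.mem_insert, not_or] at h
    obtain ⟨ht, hut, hu⟩ := h
    simp only
    rw [Finset.insert_comm u t T, smul_comm (MvPolynomial.X u : MvPolynomial (Fin n) k)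
      (koszulSign (insert u T) t), smul_comm (MvPolynomial.X t : MvPolynomial (Fin n) k)
      (koszulSign (insert t T) u), smul_comm (MvPolynomial.X u : MvPolynomial (Fin n) k)
      (MvPolynomial.X t : MvPolynomial (Fin n) k), smul_smul (koszulSign T t),
      smul_smul (koszulSign T u), ← add_smul]
    convert zero_smul ℤ _
    rcases lt_or_gt_of_ne hut with h | h
    · rw [koszulSign_insert_of_lt hu h, koszulSign_insert_of_gt h]
      ring
    · rw [koszulSign_insert_of_lt ht h, koszulSign_insert_of_gt h]
      ring
  · rintro ⟨t, u⟩ h _ h'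
    simp only [Finset.mem_sigma, Finset.mem_compl, Finset.mem_insert, not_or] at h
    simp only [Sigma.mk.injEq] at h'
    exact h.2.1 h'.1
  · rintro ⟨t, u⟩ h
    simp only [Finset.mem_sigma, Finset.mem_compl, Finset.mem_insert, not_or] at h ⊢
    exact ⟨h.2.2, fun e => h.2.1 e.symm, h.1⟩
  · rintro ⟨t, u⟩ h
    rfl

open Classical in
/-- `K(x₁, …, xₙ)` is a free resolution of `k` over `S = k[x₁, …, xₙ]`, so that `M ⊗ K(x₁, …, xₙ)`
computes `Tor^S(M, k)`: an element of `K(x₁, …, xₙ)` is a boundary iff it is a cycle and its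
component in homological degree `0` lies in the kernel of the augmentation `S → k`. -/
theorem koszulDiff_exact {k : Type*} [Field k] {n : ℕ}
    (f : Finset (Fin n) → MvPolynomial (Fin n) k) :
    (∃ g, koszulDiff k g = f) ↔
      koszulDiff k f = 0 ∧ MvPolynomial.constantCoeff (f ∅) = 0 := by
  constructor
  · rintro ⟨g, rfl⟩
    refine ⟨koszulDiff_comp_self g, ?_⟩
    simp [koszulDiff_apply]
  rintro ⟨hd, h0⟩
  -- coefficients of the differential
  have hco : ∀ (g : Finset (Fin n) → MvPolynomial (Fin n) k) (T : Finset (Fin n))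
      (b : Fin n →₀ ℕ), (koszulDiff k g T).coeff b = ∑ t ∈ Tᶜ, (koszulSign T t : k) *
        (if t ∈ b.support then (g (insert t T)).coeff (b - Finsupp.single t 1) else 0) := by
    intro g T b
    rw [koszulDiff_apply, MvPolynomial.coeff_sum]
    refine Finset.sum_congr rfl fun t _ => ?_
    rw [zsmul_eq_mul, smul_eq_mul, ← map_intCast (MvPolynomial.C (σ := Fin n) (R := k)),
      MvPolynomial.coeff_C_mul, MvPolynomial.coeff_X_mul']
  -- the contracting homotopy
  let H : Finset (Fin n) → (Fin n →₀ ℕ) → k := fun U c =>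
    if h : U.Nonempty then
      if ∀ v ∈ c.support, U.min' h ≤ v then
        (f (U.erase (U.min' h))).coeff (c + Finsupp.single (U.min' h) 1) else 0
    else 0
  have hH : ∀ (U : Finset (Fin n)) (t : Fin n) (c : Fin n →₀ ℕ), t ∈ U → (∀ v ∈ U, t ≤ v) →
      H U c = if ∀ v ∈ c.support, t ≤ v then
        (f (U.erase t)).coeff (c + Finsupp.single t 1) else 0 := by
    intro U t c ht hmin
    have hU : U.Nonempty := ⟨t, ht⟩
    have e : U.min' hU = t := le_antisymm (Finset.min'_le _ _ ht) (Finset.le_min' _ _ _ hmin)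
    simp only [H, dif_pos hU, e]
  have hfin : ∀ U, (Function.support (H U)).Finite := by
    intro U
    by_cases hU : U.Nonempty
    · refine Set.Finite.subset (((f (U.erase (U.min' hU))).support.finite_toSet).preimage
        (f := fun c => c + Finsupp.single (U.min' hU) 1) (add_left_injective _).injOn) ?_
      intro c hc
      rw [Function.mem_support] at hc
      simp only [H, dif_pos hU] at hc
      rw [Set.mem_preimage, Finset.mem_coe, MvPolynomial.mem_support_iff]
      intro h
      rw [h, ite_self] at hc
      exact hc rfl
    · convert Set.finite_empty
      ext c
      simp [H, hU]
  let g : Finset (Fin n) → MvPolynomial (Fin n) k := fun U =>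
    ∑ c ∈ (hfin U).toFinset, MvPolynomial.monomial c (H U c)
  have hg : ∀ U c, (g U).coeff c = H U c := by
    intro U c
    simp only [g, MvPolynomial.coeff_sum, MvPolynomial.coeff_monomial]
    rw [Finset.sum_ite_eq']
    split_ifs with h
    · rfl
    · simpa [eq_comm] using h
  refine ⟨g, ?_⟩
  ext T b
  rw [hco]
  simp only [hg]
  by_cases hne : (b.support ∪ T).Nonempty
  · set p := (b.support ∪ T).min' hne with hp
    have hpm : p ∈ b.support ∪ T := Finset.min'_mem _ _
    have hple : ∀ v ∈ b.support ∪ T, p ≤ v := fun v hv => Finset.min'_le _ _ hv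
    by_cases hpT : p ∈ T
    · -- use the cycle condition at `T \ {p}`
      have hc := congrArg (fun F => MvPolynomial.coeff (b + Finsupp.single p 1) (F (T.erase p))) hd
      simp only [Pi.zero_apply, MvPolynomial.coeff_zero] at hc
      rw [hco, Finset.compl_erase, Finset.sum_insert (by simpa using hpT)] at hc
      have hs1 : koszulSign (T.erase p) p = 1 := by
        unfold koszulSign
        rw [Finset.filter_false_of_mem]
        · simp
        · intro v hv
          exact not_lt.2 (hple v (Finset.mem_union_right _ (Finset.mem_of_mem_erase hv)))
      rw [hs1, if_pos (by simp), Finset.insert_erase hpT, add_tsub_cancel_right, Int.cast_one,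
        one_mul] at hc
      rw [eq_neg_of_add_eq_zero_left hc, ← Finset.sum_neg_distrib]
      refine Finset.sum_congr rfl fun u hu => ?_
      have huT : u ∉ T := by simpa using hu
      have hup : u ≠ p := fun e => huT (e ▸ hpT)
      have hiff : u ∈ (b + Finsupp.single p 1).support ↔ u ∈ b.support := by
        simp [hup.symm]
      by_cases hub : u ∈ b.support
      · have hpu : p < u := lt_of_le_of_ne (hple u (Finset.mem_union_left _ hub)) hup.symm
        rw [if_pos hub, if_pos (hiff.2 hub), hH (insert u T) p _ (by simp [hpT]) (by
          intro v hv
          rcases Finset.mem_insert.1 hv with rfl | hv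
          · exact hpu.le
          · exact hple v (Finset.mem_union_right _ hv)), if_pos]
        · have e1 : koszulSign T u = -koszulSign (T.erase p) u := by
            conv_lhs => rw [← Finset.insert_erase hpT]
            exact koszulSign_insert_of_lt (Finset.notMem_erase _ _) hpu
          have e2 : (insert u T).erase p = insert u (T.erase p) :=
            Finset.erase_insert_of_ne hup
          have e3 : b - Finsupp.single u 1 + Finsupp.single p 1 =
              b + Finsupp.single p 1 - Finsupp.single u 1 := by
            ext v
            by_cases hv : v = u
            · subst hv
              simp [hup.symm]
            · simp [Finsupp.single_apply, Ne.symm hv]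
          rw [e1, e2, e3]
          push_cast
          ring
        · intro v hv
          exact hple v (Finset.mem_union_left _ (Finsupp.support_tsub hv))
      · rw [if_neg hub, if_neg (fun h => hub (hiff.1 h))]
        simp
    · have hpb : p ∈ b.support := (Finset.mem_union.1 hpm).resolve_right hpT
      rw [Finset.sum_eq_single p]
      · have hs1 : koszulSign T p = 1 := by
          unfold koszulSign
          rw [Finset.filter_false_of_mem]
          · simp
          · intro v hv
            exact not_lt.2 (hple v (Finset.mem_union_right _ hv))
        rw [if_pos hpb, hs1, hH (insert p T) p _ (by simp) (by
          intro v hv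
          rcases Finset.mem_insert.1 hv with rfl | hv
          · exact le_rfl
          · exact hple v (Finset.mem_union_right _ hv)), if_pos, Finset.erase_insert hpT]
        · rw [tsub_add_cancel_of_le]
          · simp
          · rw [Finsupp.single_le_iff]
            exact Nat.one_le_iff_ne_zero.2 (Finsupp.mem_support_iff.1 hpb)
        · intro v hv
          exact hple v (Finset.mem_union_left _ (Finsupp.support_tsub hv))
      · intro u hu hup
        have huT : u ∉ T := by simpa using hu
        split_ifs with hub
        · have hU : (insert u T).Nonempty := Finset.insert_nonempty _ _
          have hm := Finset.min'_mem _ hU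
          have hlt : p < (insert u T).min' hU := by
            refine lt_of_le_of_ne ?_ ?_
            · rcases Finset.mem_insert.1 hm with h | h
              · rw [h]
                exact hple _ (Finset.mem_union_left _ hub)
              · exact hple _ (Finset.mem_union_right _ h)
            · intro e
              rw [← e] at hm
              rcases Finset.mem_insert.1 hm with h | h
              · exact hup h.symm
              · exact hpT h
          simp only [H, dif_pos hU]
          rw [if_neg, mul_zero]
          intro hall
          refine absurd (hall p ?_) (not_le.2 hlt)
          rw [Finsupp.mem_support_iff] at hpb ⊢
          simpa [Finsupp.single_apply, hup] using hpb
        · simp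
      · intro h
        simp [hpT] at h
  · rw [Finset.not_nonempty_iff_eq_empty, Finset.union_eq_empty, Finsupp.support_eq_empty] at hne
    obtain ⟨rfl, rfl⟩ := hne
    rw [← MvPolynomial.constantCoeff_eq, h0]
    simp

/-- For a graded `S`-module `M = ⨁_d M_d` (given by its graded pieces `ℳ d = M_d`), the piece of
homological degree `i` and internal degree `j` of `M ⊗ K(x₁, …, xₙ)`; here `e_T` has internal
degree `#T`. -/
def koszulChains {k : Type*} [Field k] {n : ℕ} {M : Type*} [AddCommGroup M] [Module k M]
    (ℳ : ℤ → Submodule k M) (i : ℕ) (j : ℤ) : Submodule k (Finset (Fin n) → M) where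
  carrier := {m | ∀ T, (T.card = i → m T ∈ ℳ (j - i)) ∧ (T.card ≠ i → m T = 0)}
  zero_mem' T := ⟨fun _ => zero_mem _, fun _ => rfl⟩
  add_mem' hm hm' T := ⟨fun (h : T.card = i) => add_mem ((hm T).1 h) ((hm' T).1 h), fun (h : T.card ≠ i) => by
    rw [Pi.add_apply, (hm T).2 h, (hm' T).2 h, add_zero]⟩
  smul_mem' c _ hm T := ⟨fun (h : T.card = i) => Submodule.smul_mem _ c ((hm T).1 h), fun (h : T.card ≠ i) => by
    rw [Pi.smul_apply, (hm T).2 h, smul_zero]⟩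

/-- The cycles of homological degree `i` and internal degree `j` in `M ⊗ K(x₁, …, xₙ)`. -/
noncomputable def koszulCycles {k : Type*} [Field k] (n : ℕ) {M : Type*} [AddCommGroup M]
    [Module k M] [Module (MvPolynomial (Fin n) k) M] [IsScalarTower k (MvPolynomial (Fin n) k) M]
    (ℳ : ℤ → Submodule k M) (i : ℕ) (j : ℤ) : Submodule k (Finset (Fin n) → M) :=
  koszulChains ℳ i j ⊓ LinearMap.ker ((koszulDiff k (n := n) (M := M)).restrictScalars k)

/-- The boundaries of homological degree `i` and internal degree `j` in `M ⊗ K(x₁, …, xₙ)`. -/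
noncomputable def koszulBoundaries {k : Type*} [Field k] (n : ℕ) {M : Type*} [AddCommGroup M]
    [Module k M] [Module (MvPolynomial (Fin n) k) M] [IsScalarTower k (MvPolynomial (Fin n) k) M]
    (ℳ : ℤ → Submodule k M) (i : ℕ) (j : ℤ) : Submodule k (Finset (Fin n) → M) :=
  (koszulChains ℳ (i + 1) j).map ((koszulDiff k (n := n) (M := M)).restrictScalars k)

/-- `Tor_i^S(M, k)_j` for a graded module `M` over `S = k[x₁, …, xₙ]`, computed with the graded free
resolution `K(x₁, …, xₙ)` of `k`: the degree `j` piece of the `i`-th homology of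
`M ⊗ K(x₁, …, xₙ)`. -/
abbrev gradedTor {k : Type*} [Field k] (n : ℕ) {M : Type*} [AddCommGroup M]
    [Module k M] [Module (MvPolynomial (Fin n) k) M] [IsScalarTower k (MvPolynomial (Fin n) k) M]
    (ℳ : ℤ → Submodule k M) (i : ℕ) (j : ℤ) : Type _ :=
  koszulCycles n ℳ i j ⧸ (koszulBoundaries n ℳ i j).submoduleOf (koszulCycles n ℳ i j)

/-- The graded Betti number `β_{i,j}(M) = dim_k Tor_i^S(M, k)_j`. -/
noncomputable def gradedBetti {k : Type*} [Field k] (n : ℕ) {M : Type*} [AddCommGroup M]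
    [Module k M] [Module (MvPolynomial (Fin n) k) M] [IsScalarTower k (MvPolynomial (Fin n) k) M]
    (ℳ : ℤ → Submodule k M) (i : ℕ) (j : ℤ) : Cardinal :=
  Module.rank k (gradedTor n ℳ i j)

/-- The set `{j - i | β_{i,j}(M) ≠ 0}`, whose maximum is the regularity of `M`. -/
def regularitySet {k : Type*} [Field k] (n : ℕ) {M : Type*} [AddCommGroup M]
    [Module k M] [Module (MvPolynomial (Fin n) k) M] [IsScalarTower k (MvPolynomial (Fin n) k) M]
    (ℳ : ℤ → Submodule k M) : Set ℤ :=
  {r | ∃ (i : ℕ) (j : ℤ), gradedBetti n ℳ i j ≠ 0 ∧ r = j - i}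

/-- The standard grading of an ideal `I` of `k[x₁, …, xₙ]` (meaningful for a homogeneous ideal):
the piece of degree `d` consists of the homogeneous polynomials of degree `d` in `I`, and it is `0`
for `d < 0`. -/
def idealGrading {k : Type*} [Field k] {n : ℕ} (I : Ideal (MvPolynomial (Fin n) k)) (d : ℤ) :
    Submodule k I where
  carrier := {f | ∀ a : Fin n →₀ ℕ, (f : MvPolynomial (Fin n) k).coeff a ≠ 0 →
    (a.degree : ℤ) = d}
  zero_mem' a h := by simp at h
  add_mem' {f g} hf hg a h := by
    by_cases hfa : (f : MvPolynomial (Fin n) k).coeff a = 0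
    · refine hg a fun hga => h ?_
      rw [Submodule.coe_add, MvPolynomial.coeff_add, hfa, hga, add_zero]
    · exact hf a hfa
  smul_mem' c f hf a h := by
    refine hf a fun hfa => h ?_
    rw [Submodule.coe_smul_of_tower, MvPolynomial.coeff_smul, hfa, smul_zero]

/-- `r` is the Castelnuovo–Mumford regularity of the ideal `I` of `k[x₁, …, xₙ]`:
`r = max {j - i | β_{i,j}(I) ≠ 0}`, and in particular the maximum exists. -/
def HasRegularity {k : Type*} [Field k] {n : ℕ} (I : Ideal (MvPolynomial (Fin n) k)) (r : ℤ) :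
    Prop :=
  IsGreatest (regularitySet n (idealGrading I)) r

/-! ### Monomial complete intersections -/

/-- `I` is a monomial complete intersection ideal: it is generated by a regular sequence of
monomials. -/
def IsMonomialCompleteIntersection {k : Type*} [Field k] {n : ℕ}
    (I : Ideal (MvPolynomial (Fin n) k)) : Prop :=
  ∃ rs : List (MvPolynomial (Fin n) k),
    (∀ f ∈ rs, ∃ A : Fin n →₀ ℕ, f = MvPolynomial.monomial A 1) ∧
    RingTheory.Sequence.IsRegular (MvPolynomial (Fin n) k) rs ∧ I = Ideal.ofList rs

/-! Write I = (x^{A_p}) with nonzero exponents A_p; a regular sequence of monomials has pairwise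
disjoint supports ("blocks"). With r generators, put D = ∑ deg A_p - r + 1. The proof shows that
reg(I) = D and that D also bounds the regularity of the integral closure.

Upper bound (`regularity_le_of_gradedBetti_ne_zero`). It applies to every monomial ideal J ⊇ I with
the property `LowerableAlong`, which both I and its integral closure have. The Koszul complex of J
splits by multidegree. If the strand at a has homology, it is not a cone with apex v for any v in
the support of a, so for each such v some x^c ∈ J with c_v = a_v leaves J when divided by x_v.
Lowerability turns this into inequalities between the ratios a_w / A_p(w) inside a block. Since x^{c
- e_v} ∉ I, every block also contains a coordinate where a is small. Together these give a ≤ A_p on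
each block, with enough strict inequalities to sum up to deg a - i ≤ D.

Lower bound (`gradedBetti_monomialSpan_ne_zero`). For r = m + 1 and a = ∑ A_p, choose V with one
variable from each block. The boundary of x^{a - 1_V} e_V is a cycle with coefficients in I. It does
not bound there: the cochain `incidenceDet`, a product of the indicators of the blocks, vanishes on
boundaries and on chains over I in multidegree a, but not on x^{a - 1_V} e_V. So Tor_m is nonzero in
degree deg a, and deg a - m = D. -/

open MvPolynomial

/-! ### Monomial ideals and their integral closures -/

/-- `J` contains every term of each of its elements. -/
def IsMonomialIdeal {k : Type*} [Field k] {σ : Type*} (J : Ideal (MvPolynomial σ k)) : Prop :=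
  ∀ f ∈ J, ∀ b, monomial b (f.coeff b) ∈ J

/-- The substitution x_j ↦ x_j X_j separates the terms of a polynomial into coefficients of
different monomials in X. It carries the Rees algebra ℛ of I into ℛ[X], because the powers of I are
monomial, so the image of f t is integral over ℛ[X]. A polynomial integral over ℛ[X] has
coefficients integral over ℛ, and these coefficients are the terms of f times t. -/
theorem integral_monomial_of_integral {k : Type*} [Field k] {σ : Type*}
    {I : Ideal (MvPolynomial σ k)}
    (hpow : ∀ i, IsMonomialIdeal (I ^ i))
    {f : MvPolynomial σ k} (hf : IsIntegralOverIdeal I f) (b : σ →₀ ℕ) :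
    IsIntegralOverIdeal I (monomial b (f.coeff b)) := by
  let _ : Algebra (MvPolynomial σ (reesAlgebra I))
      (MvPolynomial σ (Polynomial (MvPolynomial σ k))) :=
    MvPolynomial.algebraMvPolynomial
  let ψ : MvPolynomial σ k →+* MvPolynomial σ (MvPolynomial σ k) :=
    (aeval (R := k) fun j => C (X j) * X j).toRingHom
  have hψ : ∀ g b, (ψ g).coeff b = monomial b (g.coeff b) := by
    intro g b
    have key : ∀ c (x : k), ψ (monomial c x) = monomial c (monomial c x) := by
      intro c x
      change aeval (R := k) (fun j => C (X j) * X j : σ → MvPolynomial σ (MvPolynomial σ k))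
        (monomial c x) = _
      rw [aeval_monomial]
      simp only [mul_pow, Finsupp.prod_mul]
      have h1 : (c.prod fun i m =>
          (C (X i : MvPolynomial σ k) : MvPolynomial σ (MvPolynomial σ k)) ^ m)
          = C (monomial c 1) := by
        rw [monomial_eq, C_1, one_mul, Finsupp.prod, Finsupp.prod, map_prod]
        simp
      have h2 : (c.prod fun i m => (X i : MvPolynomial σ (MvPolynomial σ k)) ^ m) = monomial c 1 := by
        rw [monomial_eq, C_1, one_mul]
      rw [h1, h2, C_mul_monomial, IsScalarTower.algebraMap_apply k (MvPolynomial σ k),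
        MvPolynomial.algebraMap_eq, MvPolynomial.algebraMap_eq, C_mul_monomial, mul_one,
        C_mul_monomial, mul_one]
    induction g using MvPolynomial.induction_on' with
    | monomial c x =>
      classical
      rw [key, coeff_monomial, coeff_monomial]
      split_ifs with h
      · rw [h]
      · simp
    | add p q hp hq => rw [map_add, coeff_add, coeff_add, hp, hq, map_add]
  let Ψ : Polynomial (MvPolynomial σ k) →+* MvPolynomial σ (Polynomial (MvPolynomial σ k)) :=
    Polynomial.eval₂RingHom ((MvPolynomial.map Polynomial.C).comp ψ) (C Polynomial.X)
  have hΨm : ∀ i g b, (Ψ (Polynomial.monomial i g)).coeff b =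
      Polynomial.monomial i (monomial b (g.coeff b)) := by
    intro i g b
    simp only [Ψ, Polynomial.coe_eval₂RingHom, Polynomial.eval₂_monomial, RingHom.comp_apply]
    rw [mul_comm, ← C_pow, coeff_C_mul, coeff_map, hψ, mul_comm, Polynomial.C_mul_X_pow_eq_monomial]
  have hΨ : ∀ g b i, ((Ψ g).coeff b).coeff i = monomial b ((g.coeff i).coeff b) := by
    intro g b i
    induction g using Polynomial.induction_on' with
    | monomial j x =>
      rw [hΨm, Polynomial.coeff_monomial, Polynomial.coeff_monomial]
      split_ifs <;> simp
    | add p q hp hq =>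
      rw [map_add, coeff_add, Polynomial.coeff_add, hp, hq, Polynomial.coeff_add, coeff_add, map_add]
  rw [isIntegralOverIdeal_iff_rees] at hf ⊢
  obtain ⟨p, hp, hp0⟩ := hf
  have hint : IsIntegral (MvPolynomial σ (reesAlgebra I)) (Ψ (Polynomial.monomial 1 f)) := by
    have hl : p.map (Ψ.comp (algebraMap (reesAlgebra I) _)) ∈ Polynomial.lifts
        (algebraMap (MvPolynomial σ (reesAlgebra I))
          (MvPolynomial σ (Polynomial (MvPolynomial σ k)))) := by
      rw [Polynomial.lifts_iff_coeff_lifts]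
      intro i
      rw [Polynomial.coeff_map, RingHom.comp_apply, MvPolynomial.algebraMap_def]
      set g := p.coeff i
      change _ ∈ Set.range (MvPolynomial.map
        (algebraMap (reesAlgebra I) (Polynomial (MvPolynomial σ k))))
      rw [MvPolynomial.mem_range_map_iff_coeffs_subset]
      intro x hx
      obtain ⟨b, -, rfl⟩ := (mem_coeffs_iff).1 hx
      -- Each X-coefficient again lies in the Rees algebra: its part of degree i in t is a term of
      -- an element of I^i.
      refine ⟨⟨_, fun i => ?_⟩, rfl⟩
      exact (hΨ g b i).symm ▸ hpow _ _ (g.2 i) _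
    obtain ⟨q, hq, -, hqm⟩ := Polynomial.lifts_and_natDegree_eq_and_monic hl (hp.map _)
    refine ⟨q, hqm, ?_⟩
    rw [← Polynomial.eval_map, hq, Polynomial.eval_map, ← Polynomial.hom_eval₂, hp0, map_zero]
  have := MvPolynomial.isIntegral_iff_isIntegral_coeff.1 hint b
  rwa [hΨm] at this

section Monomial
variable {k : Type*} [Field k] {σ : Type*}

theorem monomial_mem_iff {J : Ideal (MvPolynomial σ k)} {b : σ →₀ ℕ} {c : k} (hc : c ≠ 0) :
    monomial b c ∈ J ↔ monomial b 1 ∈ J := by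
  have h1 : monomial b c = C c * monomial b (1 : k) := by rw [C_mul_monomial, mul_one]
  have h2 : monomial b (1 : k) = C c⁻¹ * monomial b c := by
    rw [C_mul_monomial, inv_mul_cancel₀ hc]
  exact ⟨fun h => h2 ▸ J.mul_mem_left _ h, fun h => h1 ▸ J.mul_mem_left _ h⟩

theorem IsMonomialIdeal.mem_iff {J : Ideal (MvPolynomial σ k)} (hJ : IsMonomialIdeal J)
    {f : MvPolynomial σ k} : f ∈ J ↔ ∀ b, f.coeff b ≠ 0 → monomial b 1 ∈ J := by
  refine ⟨fun hf b hb => (monomial_mem_iff hb).1 (hJ f hf b), fun h => ?_⟩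
  rw [f.as_sum]
  exact J.sum_mem fun b hb =>
    (monomial_mem_iff (mem_support_iff.1 hb)).2 (h b (mem_support_iff.1 hb))

theorem isMonomialIdeal_span (B : Set (σ →₀ ℕ)) :
    IsMonomialIdeal (Ideal.span ((fun s => monomial s (1 : k)) '' B)) := by
  classical
  intro f hf b
  by_cases hb : f.coeff b = 0
  · simp [hb]
  rw [mem_ideal_span_monomial_image] at hf ⊢
  intro c hc
  have : c = b := by simpa [coeff_monomial, hb, eq_comm] using hc
  exact this ▸ hf b (mem_support_iff.2 hb)

theorem monomial_mem_span_iff {B : Set (σ →₀ ℕ)} {b : σ →₀ ℕ} :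
    monomial b 1 ∈ Ideal.span ((fun s => monomial s (1 : k)) '' B) ↔ ∃ c ∈ B, c ≤ b := by
  classical
  rw [mem_ideal_span_monomial_image]
  simp [coeff_monomial]

/-- The ideal generated by the monomials with exponents `A i`. -/
noncomputable def monomialSpan (k : Type*) [Field k] {σ ι : Type*} (A : ι → σ →₀ ℕ) :
    Ideal (MvPolynomial σ k) :=
  Ideal.span ((fun s => monomial s (1 : k)) '' Set.range A)

theorem isMonomialIdeal_monomialSpan {ι : Type*} (A : ι → σ →₀ ℕ) :
    IsMonomialIdeal (monomialSpan k A) := isMonomialIdeal_span _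

theorem monomial_mem_monomialSpan {ι : Type*} {A : ι → σ →₀ ℕ} {b : σ →₀ ℕ} :
    monomial b 1 ∈ monomialSpan k A ↔ ∃ i, A i ≤ b := by
  simp [monomialSpan, monomial_mem_span_iff]

theorem monomialSpan_pow {ι : Type*} [Fintype ι] (A : ι → σ →₀ ℕ) (N : ℕ) :
    monomialSpan k A ^ N = Ideal.span ((fun s => monomial s (1 : k)) ''
      {c | ∃ e : ι → ℕ, ∑ i, e i = N ∧ ∑ i, e i • A i = c}) := by
  classical
  induction N with
  | zero =>
    rw [pow_zero, Ideal.one_eq_top, eq_comm, Ideal.eq_top_iff_one]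
    refine Ideal.subset_span ⟨0, ⟨0, by simp⟩, by simp⟩
  | succ N ih =>
    rw [pow_succ, ih, monomialSpan, Ideal.span_mul_span']
    congr 1
    ext f
    constructor
    · rintro ⟨_, ⟨_, ⟨e, he, rfl⟩, rfl⟩, _, ⟨_, ⟨j, rfl⟩, rfl⟩, rfl⟩
      refine ⟨_, ⟨e + Pi.single j 1, ?_, rfl⟩, ?_⟩
      · simp [Finset.sum_add_distrib, he]
      · simp [add_smul, Finset.sum_add_distrib, Pi.single_apply, ite_smul, monomial_mul]
    · rintro ⟨_, ⟨e, he, rfl⟩, rfl⟩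
      obtain ⟨j, hj⟩ : ∃ j, e j ≠ 0 := by
        by_contra! h
        simp [h] at he
      have hej : e = (e - Pi.single j 1) + Pi.single j 1 := by
        ext i
        by_cases hij : i = j
        · subst hij; simp; omega
        · simp [hij]
      refine ⟨_, ⟨_, ⟨e - Pi.single j 1, ?_, rfl⟩, rfl⟩, _, ⟨_, ⟨j, rfl⟩, rfl⟩, ?_⟩
      · rw [hej] at he
        simp only [Pi.add_apply, Finset.sum_add_distrib, Finset.sum_pi_single', Finset.mem_univ,
          if_true] at he
        omega
      · conv_rhs => rw [hej]
        simp [-Pi.sub_apply, add_smul, Finset.sum_add_distrib, Pi.single_apply, ite_smul,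
          monomial_mul]

theorem le_idealIntegralClosure {R : Type*} [CommRing R] (I : Ideal R) :
    I ≤ idealIntegralClosure I := fun x hx =>
  ⟨1, le_rfl, fun _ => -x, by simpa using hx, by simp⟩

theorem mem_idealIntegralClosure_of_pow_mem {R : Type*} [CommRing R] {I : Ideal R} {x : R} {N : ℕ}
    (hN : 1 ≤ N) (h : x ^ N ∈ I ^ N) : x ∈ idealIntegralClosure I := by
  refine ⟨N, hN, Pi.single N (-x ^ N), fun i _ => ?_, ?_⟩
  · by_cases hi : i = N
    · subst hi; simpa using h
    · simp [hi]
  · rw [Finset.sum_eq_single N]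
    · simp
    · intro i _ hi
      simp [hi]
    · intro h
      simp [hN] at h

theorem isMonomialIdeal_idealIntegralClosure {ι : Type*} [Fintype ι] (A : ι → σ →₀ ℕ) :
    IsMonomialIdeal (idealIntegralClosure (monomialSpan k A)) := fun _ hf b =>
  integral_monomial_of_integral
    (fun i => by rw [monomialSpan_pow]; exact isMonomialIdeal_span _) hf b

/-- In an integral equation of degree m for x^b, the term x^{mb} must be cancelled by some a_i
x^{(m-i)b}. Then x^{ib} occurs in a_i ∈ I^i, and N = i works. Conversely, x^{Nb} ∈ I^N suffices. -/
theorem monomial_mem_idealIntegralClosure {ι : Type*} [Fintype ι] {A : ι → σ →₀ ℕ} {b : σ →₀ ℕ} :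
    monomial b 1 ∈ idealIntegralClosure (monomialSpan k A) ↔
      ∃ N, 1 ≤ N ∧ ∃ e : ι → ℕ, ∑ i, e i = N ∧ ∑ i, e i • A i ≤ N • b := by
  constructor
  · classical
    rintro ⟨m, -, a, ha, h⟩
    have h1 := congrArg (coeff (m • b)) h
    rw [monomial_pow, one_pow, coeff_add, coeff_monomial, if_pos rfl, coeff_sum, coeff_zero] at h1
    obtain ⟨i, hi, hi0⟩ : ∃ i ∈ Finset.Icc 1 m,
        coeff (m • b) (a i * monomial b (1 : k) ^ (m - i)) ≠ 0 := by
      by_contra! h0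
      rw [Finset.sum_eq_zero h0, add_zero] at h1
      exact one_ne_zero h1
    have him := Finset.mem_Icc.1 hi
    have e : m • b = i • b + (m - i) • b := by rw [← add_smul]; congr; omega
    rw [monomial_pow, one_pow, e, coeff_mul_monomial, mul_one] at hi0
    have hia := ha i hi
    rw [monomialSpan_pow, mem_ideal_span_monomial_image] at hia
    obtain ⟨_, ⟨c, hc, rfl⟩, hle⟩ := hia _ (mem_support_iff.2 hi0)
    exact ⟨i, him.1, c, hc, hle⟩
  · rintro ⟨N, hN, e, he, hle⟩
    refine mem_idealIntegralClosure_of_pow_mem hN ?_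
    rw [monomial_pow, one_pow, monomialSpan_pow, monomial_mem_span_iff]
    exact ⟨_, ⟨e, he, rfl⟩, hle⟩

end Monomial

/-! ### Lowering exponents inside a block -/

/-- Exponents in `J` may be lowered at `v` as long as this does not lower the minimum of the ratios
`b l / A i l` over the block of `v`. -/
def LowerableAlong {k : Type*} [Field k] {σ ι : Type*} (A : ι → σ →₀ ℕ)
    (J : Ideal (MvPolynomial σ k)) : Prop :=
  ∀ (b : σ →₀ ℕ) (v : σ), monomial b 1 ∈ J → 1 ≤ b v →
    (∀ i, A i v ≠ 0 → ∃ l, A i l ≠ 0 ∧ b l * A i v ≤ (b v - 1) * A i l) →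
    monomial (b - Finsupp.single v 1) 1 ∈ J

section Lowerable
variable {k : Type*} [Field k] {σ ι : Type*} {A : ι → σ →₀ ℕ}

theorem lowerableAlong_monomialSpan : LowerableAlong A (monomialSpan k A) := by
  classical
  intro b v hb hv h
  rw [monomial_mem_monomialSpan] at hb ⊢
  obtain ⟨i, hi⟩ := hb
  refine ⟨i, fun w => ?_⟩
  by_cases hw : v = w
  · subst hw
    by_cases hiv : A i v = 0
    · simp [hiv]
    · obtain ⟨l, hl, hle⟩ := h i hiv
      have := Nat.le_of_mul_le_mul_left ((Nat.mul_le_mul_right _ (hi l)).trans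
        (hle.trans (Nat.mul_comm _ _).le)) (Nat.pos_of_ne_zero hl)
      simpa using this
  · simpa [Finsupp.single_apply, hw] using hi w

/-- For disjoint supports, ∑ e_i A_i ≤ N b says that e_i / N ≤ b_l / A_i(l) for every l in block i.
Lowering b_v therefore keeps the same N and e valid as long as (b_v - 1) / A_i(v) is at least some
other ratio of the block. -/
theorem lowerableAlong_idealIntegralClosure [Fintype ι]
    (hA : ∀ i j v, A i v ≠ 0 → A j v ≠ 0 → i = j) :
    LowerableAlong A (idealIntegralClosure (monomialSpan k A)) := by
  classical
  intro b v hb hv h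
  rw [monomial_mem_idealIntegralClosure] at hb ⊢
  obtain ⟨N, hN, e, he, hle⟩ := hb
  refine ⟨N, hN, e, he, fun w => ?_⟩
  have hsum : ∀ i w, A i w ≠ 0 → (∑ i, e i • A i) w = e i * A i w := by
    intro i w hiw
    rw [Finsupp.finsetSum_apply, Finset.sum_eq_single i]
    · simp
    · intro j _ hj
      by_cases hjw : A j w = 0
      · simp [hjw]
      · exact absurd (hA j i w hjw hiw) hj
    · simp
  by_cases hw : v = w
  · subst hw
    by_cases hiv : ∃ i, A i v ≠ 0
    · obtain ⟨i, hiv⟩ := hiv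
      obtain ⟨l, hl, hlb⟩ := h i hiv
      rw [hsum i v hiv]
      have h1 := hle l
      rw [hsum i l hl, Finsupp.smul_apply, smul_eq_mul] at h1
      have h2 : e i * A i v * A i l ≤ N * (b v - 1) * A i l := by
        calc e i * A i v * A i l = (e i * A i l) * A i v := by ring
          _ ≤ N * b l * A i v := Nat.mul_le_mul_right _ h1
          _ = N * (b l * A i v) := by ring
          _ ≤ N * ((b v - 1) * A i l) := Nat.mul_le_mul_left _ hlb
          _ = _ := by ring
      simpa using Nat.le_of_mul_le_mul_right h2 (Nat.pos_of_ne_zero hl)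
    · push Not at hiv
      rw [Finsupp.finsetSum_apply]
      simp [hiv]
  · have := hle w
    simpa [Finsupp.single_apply, hw] using this

end Lowerable

/-! ### Multigraded strands of the Koszul complex -/

section Koszul
variable {k : Type*} [Field k] {n : ℕ}

/-- Chains of homological degree `i` and internal degree `j` of the Koszul complex of `J`, as
polynomials. -/
structure IsKoszulChain (J : Ideal (MvPolynomial (Fin n) k)) (i : ℕ) (j : ℤ)
    (f : Finset (Fin n) → MvPolynomial (Fin n) k) : Prop where
  mem : ∀ T, f T ∈ J
  degree_eq : ∀ T, T.card = i → ∀ a, (f T).coeff a ≠ 0 → (a.degree : ℤ) = j - i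
  eq_zero : ∀ T, T.card ≠ i → f T = 0

theorem coe_koszulDiff {J : Ideal (MvPolynomial (Fin n) k)} (m : Finset (Fin n) → J)
    (T : Finset (Fin n)) :
    ((koszulDiff k m T : J) : MvPolynomial (Fin n) k) =
      koszulDiff k (fun U => (m U : MvPolynomial (Fin n) k)) T := by
  simp [koszulDiff_apply]

theorem mem_koszulChains_idealGrading {J : Ideal (MvPolynomial (Fin n) k)} {i : ℕ} {j : ℤ}
    {m : Finset (Fin n) → J} :
    m ∈ koszulChains (idealGrading J) i j ↔
      IsKoszulChain J i j fun T => (m T : MvPolynomial (Fin n) k) := by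
  constructor
  · intro h
    exact ⟨fun T => (m T).2, fun T hT => (h T).1 hT, fun T hT => by simp [(h T).2 hT]⟩
  · intro h T
    exact ⟨fun hT => h.degree_eq T hT, fun hT => Subtype.ext (h.eq_zero T hT)⟩

theorem gradedBetti_idealGrading_ne_zero_iff {J : Ideal (MvPolynomial (Fin n) k)} {i : ℕ} {j : ℤ} :
    gradedBetti n (idealGrading J) i j ≠ 0 ↔
      ∃ f, IsKoszulChain J i j f ∧ koszulDiff k f = 0 ∧
        ¬ ∃ g, IsKoszulChain J (i + 1) j g ∧ koszulDiff k g = f := by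
  have hquot : Nontrivial (gradedTor n (idealGrading J) i j) ↔
      (koszulBoundaries n (idealGrading J) i j).submoduleOf
        (koszulCycles n (idealGrading J) i j) ≠ ⊤ := Submodule.Quotient.nontrivial_iff
  rw [gradedBetti, Ne, rank_zero_iff, not_subsingleton_iff_nontrivial, hquot,
    Submodule.submoduleOf, Ne, Submodule.comap_subtype_eq_top, SetLike.not_le_iff_exists]
  constructor
  · rintro ⟨m, ⟨hm, hm0⟩, hmb⟩
    refine ⟨fun T => m T, mem_koszulChains_idealGrading.1 hm, ?_, ?_⟩
    · ext1 T
      rw [← coe_koszulDiff]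
      have : koszulDiff k m = 0 := hm0
      rw [this]
      rfl
    · rintro ⟨g, hg, hgm⟩
      refine hmb ⟨fun T => ⟨g T, hg.mem T⟩, mem_koszulChains_idealGrading.2 hg, ?_⟩
      ext1 T
      refine Subtype.ext ?_
      rw [LinearMap.restrictScalars_apply, coe_koszulDiff]
      exact congrFun hgm T
  · rintro ⟨f, hf, hf0, hfb⟩
    refine ⟨fun T => ⟨f T, hf.mem T⟩, ⟨mem_koszulChains_idealGrading.2 hf, ?_⟩, ?_⟩
    · rw [SetLike.mem_coe, LinearMap.mem_ker]
      ext1 T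
      refine Subtype.ext ?_
      rw [LinearMap.restrictScalars_apply, coe_koszulDiff]
      exact congrFun hf0 T
    · rintro ⟨m, hm, hmf⟩
      refine hfb ⟨fun T => m T, mem_koszulChains_idealGrading.1 hm, ?_⟩
      ext1 T
      rw [← coe_koszulDiff]
      exact congrArg Subtype.val (congrFun hmf T)

theorem coeff_koszulDiff (g : Finset (Fin n) → MvPolynomial (Fin n) k) (T : Finset (Fin n))
    (b : Fin n →₀ ℕ) : (koszulDiff k g T).coeff b = ∑ t ∈ Tᶜ, (koszulSign T t : k) *
      (if b t ≠ 0 then (g (insert t T)).coeff (b - Finsupp.single t 1) else 0) := by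
  rw [koszulDiff_apply, MvPolynomial.coeff_sum]
  refine Finset.sum_congr rfl fun t _ => ?_
  rw [zsmul_eq_mul, smul_eq_mul, ← map_intCast (MvPolynomial.C (σ := Fin n) (R := k)),
    MvPolynomial.coeff_C_mul, MvPolynomial.coeff_X_mul']
  simp only [Finsupp.mem_support_iff]

theorem koszulSign_mul_self (T : Finset (Fin n)) (t : Fin n) :
    koszulSign T t * koszulSign T t = 1 := by
  rw [koszulSign, ← mul_pow]
  simp

theorem koszulSign_insert_mul {T : Finset (Fin n)} {s t : Fin n} (hs : s ∉ T) (ht : t ∉ T)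
    (hst : s ≠ t) :
    koszulSign (insert s T) t * koszulSign (insert t T) s = -(koszulSign T t * koszulSign T s) := by
  rcases lt_or_gt_of_ne hst with h | h
  · rw [koszulSign_insert_of_lt hs h, koszulSign_insert_of_gt h, neg_mul]
  · rw [koszulSign_insert_of_lt ht h, koszulSign_insert_of_gt h, mul_neg]

/-- The exponent of the squarefree monomial with support `T`. -/
noncomputable def squarefreeExponent (T : Finset (Fin n)) : Fin n →₀ ℕ :=
  ∑ t ∈ T, Finsupp.single t 1

theorem squarefreeExponent_apply (T : Finset (Fin n)) (v : Fin n) :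
    squarefreeExponent T v = if v ∈ T then 1 else 0 := by
  simp [squarefreeExponent, Finsupp.finsetSum_apply, Finsupp.single_apply]

theorem degree_squarefreeExponent (T : Finset (Fin n)) :
    (squarefreeExponent T).degree = T.card := by
  simp [squarefreeExponent, map_sum]

theorem squarefreeExponent_insert {T : Finset (Fin n)} {t : Fin n} (ht : t ∉ T) :
    squarefreeExponent (insert t T) = Finsupp.single t 1 + squarefreeExponent T := by
  rw [squarefreeExponent, Finset.sum_insert ht, squarefreeExponent]

theorem exists_coeff_eq (H : (Fin n →₀ ℕ) → k) (hH : (Function.support H).Finite) :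
    ∃ g : MvPolynomial (Fin n) k, ∀ b, g.coeff b = H b := by
  classical
  refine ⟨∑ c ∈ hH.toFinset, monomial c (H c), fun b => ?_⟩
  simp only [coeff_sum, coeff_monomial]
  rw [Finset.sum_ite_eq']
  split_ifs with h
  · rfl
  · simpa [eq_comm] using h

/-- If the part of multidegree `a` of the Koszul complex is a cone for every `a` of degree `j`, then
every cycle is a boundary. -/
theorem exists_koszulDiff_eq_of_cone {J : Ideal (MvPolynomial (Fin n) k)} (hJ : IsMonomialIdeal J)
    {i : ℕ} {j : ℤ}
    (h : ∀ a : Fin n →₀ ℕ, (a.degree : ℤ) = j → ∃ v, 1 ≤ a v ∧ ∀ (T : Finset (Fin n))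
      (c : Fin n →₀ ℕ), T.card = i → v ∉ T → c + squarefreeExponent T = a → monomial c 1 ∈ J →
        monomial (c - Finsupp.single v 1) 1 ∈ J)
    {f : Finset (Fin n) → MvPolynomial (Fin n) k} (hf : IsKoszulChain J i j f)
    (hf0 : koszulDiff k f = 0) :
    ∃ g, IsKoszulChain J (i + 1) j g ∧ koszulDiff k g = f := by
  classical
  choose v hv1 hv using h
  -- The cone homotopy is exterior multiplication by e_v combined with division by x_v. The apex v
  -- depends on the multidegree b + 1_U of x^b e_U.
  let H : Finset (Fin n) → (Fin n →₀ ℕ) → k := fun U b =>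
    if h : ((b + squarefreeExponent U).degree : ℤ) = j then
      if v _ h ∈ U then (koszulSign (U.erase (v _ h)) (v _ h) : k) *
        (f (U.erase (v _ h))).coeff (b + Finsupp.single (v _ h) 1) else 0
    else 0
  have hfin : ∀ U, (Function.support (H U)).Finite := by
    intro U
    refine Set.Finite.subset (U.finite_toSet.biUnion fun t _ =>
      ((f (U.erase t)).support.finite_toSet).preimage
        (f := fun c => c + Finsupp.single t 1) (add_left_injective _).injOn) fun b hb => ?_
    rw [Function.mem_support] at hb
    simp only [H] at hb
    split_ifs at hb with h1 h2
    · simp only [Set.mem_iUnion]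
      exact ⟨_, h2, by simpa using right_ne_zero_of_mul hb⟩
    · exact absurd rfl hb
    · exact absurd rfl hb
  choose g hg using fun U => exists_coeff_eq (H U) (hfin U)
  have hgU : ∀ U b, (g U).coeff b ≠ 0 → U.card = i + 1 ∧ monomial b 1 ∈ J ∧
      (b.degree : ℤ) = j - (i + 1) := by
    intro U b hb
    rw [hg] at hb
    simp only [H] at hb
    split_ifs at hb with h1 h2
    · have hc := right_ne_zero_of_mul hb
      set w := v _ h1
      have hcard : (U.erase w).card = i := by
        by_contra hne
        rw [hf.eq_zero _ hne] at hc
        simp at hc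
      have hU : U.card = i + 1 := by
        rw [← Finset.card_erase_add_one h2, hcard]
      refine ⟨hU, ?_, ?_⟩
      · have := hv _ h1 (U.erase w) (b + Finsupp.single w 1) hcard (Finset.notMem_erase _ _)
          (by
            conv_rhs => rw [← Finset.insert_erase h2]
            rw [squarefreeExponent_insert (Finset.notMem_erase _ _), add_assoc])
          (hJ.mem_iff.1 (hf.mem _) _ hc)
        simpa [w] using this
      · rw [map_add, degree_squarefreeExponent, hU] at h1
        push_cast at h1
        linarith
    · exact absurd rfl hb
    · exact absurd rfl hb
  refine ⟨g, ⟨fun U => hJ.mem_iff.2 fun b hb => (hgU U b hb).2.1, fun U hU b hb => ?_,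
    fun U hU => ?_⟩, ?_⟩
  · rw [(hgU U b hb).2.2]; push_cast; ring
  · ext b
    by_contra hb
    exact hU (hgU U b (by simpa using hb)).1
  ext T b
  rw [coeff_koszulDiff]
  have hsum : ∀ t ∈ Tᶜ, b t ≠ 0 →
      b - Finsupp.single t 1 + squarefreeExponent (insert t T) = b + squarefreeExponent T := by
    intro t ht hb
    rw [squarefreeExponent_insert (by simpa using ht), ← add_assoc, tsub_add_cancel_of_le]
    exact Finsupp.single_le_iff.2 (Nat.one_le_iff_ne_zero.2 hb)
  by_cases hdeg : ((b + squarefreeExponent T).degree : ℤ) = j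
  · set w := v _ hdeg with hw
    have hHt : ∀ t ∈ Tᶜ, b t ≠ 0 → (g (insert t T)).coeff (b - Finsupp.single t 1) =
        if w ∈ insert t T then (koszulSign ((insert t T).erase w) w : k) *
        (f ((insert t T).erase w)).coeff (b - Finsupp.single t 1 + Finsupp.single w 1) else 0 := by
      intro t ht hb
      rw [hg]
      have hd : ((b - Finsupp.single t 1 + squarefreeExponent (insert t T)).degree : ℤ) = j := by
        rw [hsum t ht hb, hdeg]
      have hvw : v _ hd = w := by
        simp only [hw, hsum t ht hb]
      simp only [H, dif_pos hd, hvw]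
    by_cases hwT : w ∈ T
    -- If w ∈ T, the cycle condition at T \ {w} expresses the coefficient of f at T through the
    -- coefficients that define g.
    · have hc := congrArg (fun F => coeff (b + Finsupp.single w 1) (F (T.erase w))) hf0
      simp only [Pi.zero_apply, coeff_zero] at hc
      rw [coeff_koszulDiff, Finset.compl_erase, Finset.sum_insert (by simpa using hwT),
        if_pos (by simp), add_tsub_cancel_right, Finset.insert_erase hwT] at hc
      have hs : (koszulSign (T.erase w) w : k) * koszulSign (T.erase w) w = 1 := by
        exact_mod_cast congrArg (Int.cast (R := k)) (koszulSign_mul_self (T.erase w) w)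
      have h3 := congrArg (fun x => (koszulSign (T.erase w) w : k) * x) hc
      simp only [mul_add, ← mul_assoc, hs, one_mul, mul_zero] at h3
      rw [eq_neg_of_add_eq_zero_left h3, Finset.mul_sum, ← Finset.sum_neg_distrib]
      refine Finset.sum_congr rfl fun t ht => ?_
      have htT : t ∉ T := by simpa using ht
      have htw : t ≠ w := fun e => htT (e ▸ hwT)
      have hbt : (b + Finsupp.single w 1 : Fin n →₀ ℕ) t = b t := by simp [htw.symm]
      rw [hbt]
      by_cases hb : b t = 0
      · simp [hb]
      rw [if_pos hb, if_pos hb, hHt t ht hb, if_pos (Finset.mem_insert_of_mem hwT),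
        Finset.erase_insert_of_ne htw]
      have e3 : b - Finsupp.single t 1 + Finsupp.single w 1 =
          b + Finsupp.single w 1 - Finsupp.single t 1 := by
        rw [tsub_add_eq_add_tsub]
        exact Finsupp.single_le_iff.2 (Nat.one_le_iff_ne_zero.2 hb)
      rw [e3]
      have hs2 := congrArg (Int.cast (R := k)) (koszulSign_insert_mul (T := T.erase w) (s := w)
        (t := t) (Finset.notMem_erase _ _) (by simp [htT]) htw.symm)
      rw [Finset.insert_erase hwT] at hs2
      push_cast at hs2
      rw [← mul_assoc, hs2]
      ring
    · have hbw : b w ≠ 0 := by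
        have := hv1 _ hdeg
        rw [← hw, Finsupp.add_apply, squarefreeExponent_apply, if_neg hwT] at this
        omega
      have hwc : w ∈ Tᶜ := by simpa using hwT
      -- If w ∉ T, g vanishes on `insert t T` for t ≠ w, so only t = w contributes.
      rw [Finset.sum_eq_single w]
      · rw [if_pos hbw, hHt w hwc hbw, if_pos (Finset.mem_insert_self _ _),
          Finset.erase_insert hwT, tsub_add_cancel_of_le
            (Finsupp.single_le_iff.2 (Nat.one_le_iff_ne_zero.2 hbw)), ← mul_assoc]
        have hs : (koszulSign T w : k) * koszulSign T w = 1 := by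
          exact_mod_cast congrArg (Int.cast (R := k)) (koszulSign_mul_self T w)
        rw [hs, one_mul]
      · intro t ht htw
        by_cases hb : b t = 0
        · simp [hb]
        · rw [if_pos hb, hHt t ht hb, if_neg, mul_zero]
          simp [hwT, Ne.symm htw]
      · intro h
        exact absurd hwc h
  · have hfT : (f T).coeff b = 0 := by
      by_contra hb
      by_cases hT : T.card = i
      · have := hf.degree_eq T hT b hb
        rw [map_add, degree_squarefreeExponent, hT] at hdeg
        push_cast at hdeg
        exact hdeg (by linarith)
      · rw [hf.eq_zero T hT] at hb
        simp at hb
    rw [hfT]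
    refine Finset.sum_eq_zero fun t ht => ?_
    by_cases hb : b t = 0
    · simp [hb]
    · rw [if_pos hb, hg]
      simp only [H]
      rw [dif_neg, mul_zero]
      rw [hsum t ht hb]
      exact hdeg

theorem exists_of_gradedBetti_ne_zero {J : Ideal (MvPolynomial (Fin n) k)}
    (hJ : IsMonomialIdeal J) {i : ℕ} {j : ℤ} (h : gradedBetti n (idealGrading J) i j ≠ 0) :
    ∃ a : Fin n →₀ ℕ, (a.degree : ℤ) = j ∧ ∀ v, 1 ≤ a v → ∃ (T : Finset (Fin n))
      (c : Fin n →₀ ℕ), T.card = i ∧ v ∉ T ∧ c + squarefreeExponent T = a ∧ monomial c 1 ∈ J ∧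
        monomial (c - Finsupp.single v 1) 1 ∉ J := by
  obtain ⟨f, hf, hf0, hfb⟩ := gradedBetti_idealGrading_ne_zero_iff.1 h
  by_contra! hcon
  exact hfb (exists_koszulDiff_eq_of_cone hJ hcon hf hf0)

end Koszul

/-! ### The upper bound, and existence of the regularity -/

section Bound
variable {k : Type*} [Field k] {n : ℕ}

theorem regularity_le_of_gradedBetti_ne_zero {ι : Type*} [Fintype ι] {A : ι → Fin n →₀ ℕ}
    (hA : ∀ i j v, A i v ≠ 0 → A j v ≠ 0 → i = j) (hA0 : ∀ i, A i ≠ 0)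
    {J : Ideal (MvPolynomial (Fin n) k)} (hAJ : monomialSpan k A ≤ J) (hJ : IsMonomialIdeal J)
    (hlow : LowerableAlong A J) {i : ℕ} {j : ℤ} (h : gradedBetti n (idealGrading J) i j ≠ 0) :
    j - i ≤ (∑ p, ((A p).degree : ℤ)) - Fintype.card ι + 1 := by
  classical
  obtain ⟨a, rfl, ha⟩ := exists_of_gradedBetti_ne_zero hJ h
  -- With a = 0 there is no variable to use as apex, but then j = 0, and the right side is positive
  -- because each A_p has degree at least 1.
  by_cases ha0 : a = 0
  · have : ∑ p : ι, (1 : ℤ) ≤ ∑ p, ((A p).degree : ℤ) := Finset.sum_le_sum fun p _ => by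
      have : (A p).degree ≠ 0 := fun h0 => hA0 p ((Finsupp.degree_eq_zero_iff _).1 h0)
      omega
    simp only [Finset.sum_const, Finset.card_univ, nsmul_eq_mul, mul_one] at this
    subst ha0
    simp only [map_zero]
    omega
  -- Otherwise lowerability would allow x^c to be divided by x_w inside J. The inequality passes
  -- from c to a since c_w = a_w and c ≤ a.
  have hblock : ∀ w, 1 ≤ a w → ∃ p, A p w ≠ 0 ∧ ∀ l, A p l ≠ 0 →
      (a w - 1) * A p l < a l * A p w := by
    intro w hw
    obtain ⟨T, c, -, hwT, hca, hc, hc'⟩ := ha w hw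
    have hcw : c w = a w := by
      rw [← hca, Finsupp.add_apply, squarefreeExponent_apply, if_neg hwT, add_zero]
    by_contra! hcon
    refine hc' (hlow c w hc (hcw ▸ hw) fun p hp => ?_)
    obtain ⟨l, hl, hle⟩ := hcon p hp
    refine ⟨l, hl, hcw.symm ▸ le_trans (Nat.mul_le_mul_right _ ?_) hle⟩
    rw [← hca]
    simp
  obtain ⟨v, hv⟩ : ∃ v, 1 ≤ a v := by
    by_contra! h0
    exact ha0 (Finsupp.ext fun v => by simpa using h0 v)
  obtain ⟨T, c, hT, hvT, hca, -, hc'⟩ := ha v hv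
  have hac : ∀ l, a l = c l + if l ∈ T then 1 else 0 := fun l => by
    rw [← hca, Finsupp.add_apply, squarefreeExponent_apply]
  -- From here on v, T and c are fixed. Since x^{c - e_v} ∉ I, each A_p exceeds c - e_v at some l;
  -- rewriting c - e_v as a - 1_T - e_v gives the correction terms.
  have hstrict : ∀ p, ∃ l, A p l ≠ 0 ∧
      a l + 1 ≤ A p l + ((if l ∈ T then 1 else 0) + if l = v then 1 else 0) := by
    intro p
    have hp : ¬ A p ≤ c - Finsupp.single v 1 := fun hle =>
      hc' (hAJ (monomial_mem_monomialSpan.2 ⟨p, hle⟩))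
    rw [Finsupp.le_def] at hp
    push Not at hp
    obtain ⟨l, hl⟩ := hp
    refine ⟨l, by omega, ?_⟩
    rw [Finsupp.tsub_apply, Finsupp.single_apply] at hl
    have h1 := hac l
    simp only [eq_comm (a := v)] at hl
    split_ifs at hl h1 ⊢ <;> omega
  -- As v ∉ T, the correction at l is at most 1, so a_l ≤ A_p(l). Then (a_w - 1) A_p(l) < a_l A_p(w)
  -- ≤ A_p(l) A_p(w) yields a_w ≤ A_p(w).
  have hle : ∀ p w, A p w ≠ 0 → a w ≤ A p w := by
    intro p w hpw
    by_cases hw : a w = 0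
    · omega
    obtain ⟨q, hq, hql⟩ := hblock w (Nat.one_le_iff_ne_zero.2 hw)
    obtain rfl := hA q p w hq hpw
    obtain ⟨l, hl0, hl⟩ := hstrict q
    have hal : a l ≤ A q l := by
      have : l = v → l ∉ T := fun e => e ▸ hvT
      split_ifs at hl with h1 h2 <;> first | omega | exact absurd h1 (this h2)
    have h2 : (a w - 1) * A q l < A q w * A q l :=
      (hql l hl0).trans_le (by rw [mul_comm (A q w)]; exact Nat.mul_le_mul_right _ hal)
    have := Nat.lt_of_mul_lt_mul_right h2
    omega
  -- Each block gains 1 from its strict coordinate l. The corrections over all blocks total at most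
  -- #(T ∪ {v}) = i + 1.
  have hsum : ∀ p, (∑ w, if A p w ≠ 0 then a w else 0) + 1 ≤ (A p).degree +
      ∑ w, if A p w ≠ 0 then ((if w ∈ T then 1 else 0) + if w = v then 1 else 0) else 0 := by
    intro p
    rw [Finsupp.degree_eq_sum, ← Finset.sum_add_distrib]
    refine Nat.succ_le_of_lt (Finset.sum_lt_sum (fun w _ => ?_) ?_)
    · split_ifs with h1
      all_goals have := hle p w
      all_goals omega
    · obtain ⟨l, hl0, hl⟩ := hstrict p
      refine ⟨l, Finset.mem_univ _, ?_⟩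
      rw [if_pos hl0, if_pos hl0]
      omega
  have htot := Finset.sum_le_sum fun p (_ : p ∈ (Finset.univ : Finset ι)) => hsum p
  rw [Finset.sum_add_distrib, Finset.sum_add_distrib, Finset.sum_comm,
    Finset.sum_comm (s := Finset.univ) (t := Finset.univ)
      (f := fun p w => if A p w ≠ 0 then
        ((if w ∈ T then 1 else 0) + if w = v then 1 else 0) else 0)] at htot
  have hl : a.degree ≤ ∑ w, ∑ p, if A p w ≠ 0 then a w else 0 := by
    rw [Finsupp.degree_eq_sum]
    refine Finset.sum_le_sum fun w _ => ?_
    by_cases hw : a w = 0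
    · omega
    obtain ⟨p, hp, -⟩ := hblock w (Nat.one_le_iff_ne_zero.2 hw)
    calc a w = if A p w ≠ 0 then a w else 0 := (if_pos hp).symm
      _ ≤ _ := Finset.single_le_sum (f := fun p => if A p w ≠ 0 then a w else 0)
        (fun _ _ => Nat.zero_le _) (Finset.mem_univ p)
  have hr : (∑ w, ∑ p : ι,
      if A p w ≠ 0 then ((if w ∈ T then 1 else 0) + if w = v then 1 else 0) else 0) ≤ i + 1 := by
    calc _ ≤ ∑ w, ((if w ∈ T then 1 else 0) + if w = v then 1 else 0) := by
          refine Finset.sum_le_sum fun w _ => ?_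
          by_cases hw : ∃ p, A p w ≠ 0
          · obtain ⟨p, hp⟩ := hw
            rw [Finset.sum_eq_single p]
            · rw [if_pos hp]
            · intro q _ hq
              exact if_neg fun hqw => hq (hA q p w hqw hp)
            · simp
          · push Not at hw
            simp [hw]
      _ = i + 1 := by simp [Finset.sum_add_distrib, hT]
  rw [Finset.sum_const, Finset.card_univ, smul_eq_mul, mul_one] at htot
  have : a.degree + Fintype.card ι ≤ (∑ p, (A p).degree) + (i + 1) := by omega
  have h2 : (∑ p, ((A p).degree : ℤ)) = ((∑ p, (A p).degree : ℕ) : ℤ) := by push_cast; rfl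
  rw [h2]
  omega

/-- A monomial of least degree in J is a minimal generator, hence a nonzero class in Tor_0. -/
theorem regularitySet_nonempty {J : Ideal (MvPolynomial (Fin n) k)} (hJ : IsMonomialIdeal J)
    (hJ0 : J ≠ ⊥) : (regularitySet n (idealGrading J)).Nonempty := by
  classical
  have hex : ∃ d, ∃ b : Fin n →₀ ℕ, b.degree = d ∧ monomial b (1 : k) ∈ J := by
    obtain ⟨f, hf, hf0⟩ := Submodule.exists_mem_ne_zero_of_ne_bot hJ0
    obtain ⟨b, hb⟩ := MvPolynomial.ne_zero_iff.1 hf0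
    exact ⟨_, b, rfl, hJ.mem_iff.1 hf b hb⟩
  obtain ⟨b, hbd, hb⟩ := Nat.find_spec hex
  have hmin : ∀ c : Fin n →₀ ℕ, monomial c (1 : k) ∈ J → b.degree ≤ c.degree := fun c hc =>
    hbd ▸ Nat.find_min' hex ⟨c, rfl, hc⟩
  refine ⟨_, 0, b.degree, gradedBetti_idealGrading_ne_zero_iff.2
    ⟨Pi.single ∅ (monomial b 1), ⟨fun T => ?_, fun T hT c hc => ?_, fun T hT => ?_⟩, ?_, ?_⟩, rfl⟩
  · by_cases hT : T = ∅
    · subst hT; simpa using hb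
    · simp [hT]
  · obtain rfl := Finset.card_eq_zero.1 hT
    have : c = b := by
      by_contra hcb
      simp [coeff_monomial, Ne.symm hcb] at hc
    simp [this]
  · have : T ≠ ∅ := fun h => hT (by simp [h])
    simp [this]
  · ext1 T
    rw [koszulDiff_apply]
    simp
  · rintro ⟨g, hg, hgb⟩
    have h1 := congrFun hgb ∅
    rw [koszulDiff_apply, Pi.single_eq_same, Finset.sum_eq_zero] at h1
    · exact one_ne_zero ((monomial_eq_zero (R := k)).1 h1.symm)
    · intro t _
      have : g (insert t ∅) = 0 := by
        by_contra hne
        obtain ⟨c, hc⟩ := MvPolynomial.ne_zero_iff.1 hne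
        have h2 := hg.degree_eq _ (by simp) c hc
        have h3 := hmin c (hJ.mem_iff.1 (hg.mem _) c hc)
        push_cast at h2
        omega
      rw [this, smul_zero, smul_zero]

theorem exists_hasRegularity {J : Ideal (MvPolynomial (Fin n) k)} (hJ : IsMonomialIdeal J)
    (hJ0 : J ≠ ⊥) {D : ℤ} (hD : ∀ r ∈ regularitySet n (idealGrading J), r ≤ D) :
    ∃ r, HasRegularity J r :=
  let ⟨r, hr, hr'⟩ := Int.exists_greatest_of_bdd ⟨D, hD⟩ (regularitySet_nonempty hJ hJ0)
  ⟨r, hr, hr'⟩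

end Bound

/-! ### Regular sequences of monomials have disjoint supports -/

section RegularSequence
variable {k : Type*} [Field k]

theorem disjoint_of_lt_of_colon {σ : Type*} {r : ℕ} {A : Fin r → σ →₀ ℕ} (hA0 : ∀ i, A i ≠ 0)
    (hreg : ∀ i b, (∃ p < i, A p ≤ A i + b) → ∃ p < i, A p ≤ b) (j : Fin r) :
    ∀ i < j, ∀ v, A i v ≠ 0 → A j v = 0 := by
  classical
  induction j using WellFoundedLT.induction with
  | ind j ih =>
    intro i hij v hi
    by_contra hj
    -- If v lies in both supports, x^{A_j} x^{A_i - e_v} is divisible by x^{A_i}, so regularity puts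
    -- x^{A_i - e_v} in the ideal of the earlier generators. The dividing generator x^{A_p} is not
    -- x^{A_i}, and for p ≠ i the induction makes A_p disjoint from A_i, forcing A_p = 0.
    obtain ⟨p, hpj, hp⟩ := hreg j (A i - Finsupp.single v 1) ⟨i, hij, fun w => by
      by_cases hw : v = w
      · subst hw
        simp only [Finsupp.add_apply, Finsupp.tsub_apply, Finsupp.single_eq_same]
        omega
      · simp [hw]⟩
    rcases lt_trichotomy p i with h | rfl | h
    · refine hA0 p (Finsupp.ext fun w => ?_)
      by_contra hw
      have h1 := (hp.trans tsub_le_self) w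
      have h2 := ih i hij p h w hw
      exact hw (by simpa [h2] using h1)
    · have := hp v
      simp only [Finsupp.tsub_apply, Finsupp.single_eq_same] at this
      omega
    · refine hA0 p (Finsupp.ext fun w => ?_)
      by_contra hw
      have h1 := (hp.trans tsub_le_self) w
      by_cases h2 : A i w = 0
      · exact hw (by simpa [h2] using h1)
      · exact hw (ih p hpj i h w h2)

theorem exists_exponents_of_isMonomialCompleteIntersection {n : ℕ}
    {I : Ideal (MvPolynomial (Fin n) k)} (hI : IsMonomialCompleteIntersection I) (hI0 : I ≠ ⊥) :
    ∃ (m : ℕ) (A : Fin (m + 1) → Fin n →₀ ℕ), (∀ i, A i ≠ 0) ∧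
      (∀ i j v, A i v ≠ 0 → A j v ≠ 0 → i = j) ∧ I = monomialSpan k A := by
  obtain ⟨rs, hmon, hreg, rfl⟩ := hI
  obtain ⟨m, hm⟩ : ∃ m, rs.length = m + 1 := by
    refine Nat.exists_eq_add_one.2 (List.length_pos_iff.2 fun h => hI0 ?_)
    rw [h, Ideal.ofList_nil]
  have hmon' : ∀ i : Fin (m + 1), ∃ A, rs[(i : ℕ)]'(by omega) = monomial A 1 := fun i =>
    hmon _ (List.getElem_mem _)
  choose A hA using hmon'
  have hspan : Ideal.ofList rs = monomialSpan k A := by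
    rw [Ideal.ofList, monomialSpan]
    congr 1
    ext f
    simp only [Set.mem_ofPred_eq, Set.mem_image, Set.mem_range, exists_exists_eq_and]
    constructor
    · intro hf
      obtain ⟨i, hi, rfl⟩ := List.mem_iff_getElem.1 hf
      exact ⟨⟨i, hm ▸ hi⟩, (hA ⟨i, hm ▸ hi⟩).symm⟩
    · rintro ⟨i, rfl⟩
      rw [← hA]
      exact List.getElem_mem _
  have htake : ∀ (i : Fin (m + 1)) b,
      monomial b (1 : k) ∈ Ideal.ofList (rs.take i) ↔ ∃ p < i, A p ≤ b := by
    intro i b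
    have : Ideal.ofList (rs.take i) =
        Ideal.span ((fun s => monomial s (1 : k)) '' (A '' {p | p < i})) := by
      rw [Ideal.ofList]
      congr 1
      ext f
      simp only [Set.mem_ofPred_eq, Set.mem_image, exists_exists_and_eq_and]
      rw [List.mem_take_iff_getElem]
      constructor
      · rintro ⟨p, hp, rfl⟩
        have hp' : p < i ∧ p < m + 1 := by omega
        exact ⟨⟨p, hp'.2⟩, hp'.1, (hA ⟨p, hp'.2⟩).symm⟩
      · rintro ⟨p, hp, rfl⟩
        rw [← hA]
        exact ⟨p, by have := p.2; have : (p : ℕ) < i := hp; omega, rfl⟩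
    rw [this, monomial_mem_span_iff]
    simp
  have hA0 : ∀ i, A i ≠ 0 := by
    intro i hi
    refine hreg.top_ne_smul ?_
    rw [smul_eq_mul, Ideal.mul_top, hspan, eq_comm, Ideal.eq_top_iff_one]
    exact monomial_mem_monomialSpan.2 ⟨i, hi.le⟩
  have hcolon : ∀ i b, (∃ p < i, A p ≤ A i + b) → ∃ p < i, A p ≤ b := by
    intro i b hp
    rw [← htake] at hp ⊢
    have h := hreg.regular_mod_prev i (by omega)
    rw [smul_eq_mul, Ideal.mul_top, isSMulRegular_quotient_iff_mem_of_smul_mem] at h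
    refine h _ ?_
    rw [hA, smul_eq_mul, monomial_mul, one_mul]
    exact hp
  refine ⟨m, A, hA0, fun i j v hi hj => ?_, hspan⟩
  rcases lt_trichotomy i j with h | h | h
  · exact absurd (disjoint_of_lt_of_colon hA0 hcolon j i h v hi) hj
  · exact h
  · exact absurd (disjoint_of_lt_of_colon hA0 hcolon i j h v hj) hi

end RegularSequence

/-! ### The lower bound: a nonzero Tor class of I -/

section LowerBound
variable {k : Type*} [Field k] {n : ℕ}

/-- The determinant of the incidence matrix between the elements of `U`, in increasing order, and
the supports of the `A i`; it is `0` if the sizes differ. -/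
noncomputable def incidenceDet (k : Type*) [Field k] {n r : ℕ} (A : Fin r → Fin n →₀ ℕ)
    (U : Finset (Fin n)) : k :=
  if h : U.card = r then
    (Matrix.of fun p q => if A q (U.orderEmbOfFin h p) ≠ 0 then (1 : k) else 0).det
  else 0

theorem koszulSign_erase_orderEmbOfFin {W : Finset (Fin n)} {r : ℕ} (h : W.card = r) (p : Fin r) :
    koszulSign (W.erase (W.orderEmbOfFin h p)) (W.orderEmbOfFin h p) = (-1) ^ (p : ℕ) := by
  have : (W.erase (W.orderEmbOfFin h p)).filter (· < W.orderEmbOfFin h p) =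
      (Finset.Iio p).map (W.orderEmbOfFin h).toEmbedding := by
    ext s
    simp only [Finset.mem_filter, Finset.mem_erase, Finset.mem_map, Finset.mem_Iio]
    constructor
    · rintro ⟨⟨-, hs⟩, hlt⟩
      rw [← Finset.map_orderEmbOfFin_univ W h, Finset.mem_map] at hs
      obtain ⟨q, -, rfl⟩ := hs
      exact ⟨q, (W.orderEmbOfFin h).lt_iff_lt.1 hlt, rfl⟩
    · rintro ⟨q, hq, rfl⟩
      have := (W.orderEmbOfFin h).lt_iff_lt.2 hq
      exact ⟨⟨this.ne, Finset.orderEmbOfFin_mem _ _ _⟩, this⟩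
  rw [koszulSign, this, Finset.card_map, Fin.card_Iio]

/-- This is the cocycle condition for `incidenceDet`. The sum is the Laplace expansion, along an
added column of ones, of the incidence matrix of W. Every element of W lies in exactly one block, so
that column is the sum of the others and the determinant is 0. -/
theorem sum_koszulSign_mul_incidenceDet {r : ℕ} {A : Fin r → Fin n →₀ ℕ}
    (hA : ∀ i j v, A i v ≠ 0 → A j v ≠ 0 → i = j) {W : Finset (Fin n)}
    (hW : ∀ w ∈ W, ∃ i, A i w ≠ 0) :
    ∑ t ∈ W, (koszulSign (W.erase t) t : k) * incidenceDet k A (W.erase t) = 0 := by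
  classical
  by_cases hcard : W.card = r + 1
  swap
  · refine Finset.sum_eq_zero fun t ht => ?_
    rw [incidenceDet, dif_neg, mul_zero]
    rw [Finset.card_erase_of_mem ht]
    have := Finset.card_pos.2 ⟨t, ht⟩
    omega
  set e := W.orderEmbOfFin hcard with he
  let N : Matrix (Fin (r + 1)) (Fin (r + 1)) k :=
    Matrix.of fun p => Fin.cons 1 fun q => if A q (e p) ≠ 0 then (1 : k) else 0
  have hN : N.det = 0 := by
    rw [← Matrix.exists_mulVec_eq_zero_iff]
    refine ⟨Fin.cons (-1) fun _ => 1, fun h => ?_, ?_⟩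
    · have := congrFun h 0
      simp at this
    · ext p
      obtain ⟨i, hi⟩ := hW (e p) (Finset.orderEmbOfFin_mem _ _ _)
      have : ∀ q, (if A q (e p) ≠ 0 then (1 : k) else 0) = if q = i then 1 else 0 := by
        intro q
        by_cases hq : q = i
        · subst hq; simp [hi]
        · rw [if_neg hq, if_neg fun h => hq (hA _ _ _ h hi)]
      simp only [N, Matrix.mulVec, dotProduct, Fin.sum_univ_succ, Matrix.of_apply, Fin.cons_zero,
        Fin.cons_succ, this]
      simp
  rw [Matrix.det_succ_column_zero] at hN
  rw [← hN]
  conv_lhs => rw [← Finset.map_orderEmbOfFin_univ W hcard]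
  rw [Finset.sum_map]
  refine Finset.sum_congr rfl fun p _ => ?_
  change (koszulSign ((Finset.univ.map e.toEmbedding).erase (e p)) (e p) : k) *
    incidenceDet k A ((Finset.univ.map e.toEmbedding).erase (e p)) = _
  rw [he, Finset.map_orderEmbOfFin_univ W hcard, koszulSign_erase_orderEmbOfFin, incidenceDet,
    dif_pos (by rw [Finset.card_erase_of_mem (Finset.orderEmbOfFin_mem _ _ _), hcard]; rfl)]
  have hemb : ∀ h, ((W.erase (e p)).orderEmbOfFin h : Fin r → Fin n) = e ∘ p.succAbove := by
    intro h
    refine (Finset.orderEmbOfFin_unique h (fun x => ?_)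
      (e.strictMono.comp (Fin.strictMono_succAbove p))).symm
    refine Finset.mem_erase.2 ⟨fun h => ?_, Finset.orderEmbOfFin_mem _ _ _⟩
    exact Fin.succAbove_ne p x (e.injective h)
  simp only [Int.cast_pow, Int.cast_neg, Int.cast_one]
  congr 1
  · simp [N]
  · congr 1
    ext x y
    simp [N, hemb, ← he]

/-- For a transversal of the blocks the rows of the matrix are the unit vectors in some order, so
its kernel is zero. -/
theorem incidenceDet_ne_zero {r : ℕ} {A : Fin r → Fin n →₀ ℕ}
    (hA : ∀ i j v, A i v ≠ 0 → A j v ≠ 0 → i = j) {v : Fin r → Fin n} (hv : ∀ i, A i (v i) ≠ 0) :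
    incidenceDet k A (Finset.univ.image v) ≠ 0 := by
  classical
  have hinj : Function.Injective v := fun p q h => hA p q (v p) (hv p) (h ▸ hv q)
  have hcard : (Finset.univ.image v).card = r := by
    rw [Finset.card_image_of_injective _ hinj, Finset.card_univ, Fintype.card_fin]
  rw [incidenceDet, dif_pos hcard, Ne, ← Matrix.exists_mulVec_eq_zero_iff]
  rintro ⟨x, hx0, hx⟩
  refine hx0 (funext fun q => ?_)
  have hq : v q ∈ Finset.univ.map ((Finset.univ.image v).orderEmbOfFin hcard).toEmbedding := by
    rw [Finset.map_orderEmbOfFin_univ]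
    exact Finset.mem_image_of_mem _ (Finset.mem_univ _)
  obtain ⟨p, -, hp⟩ := Finset.mem_map.1 hq
  have hp' : (Finset.univ.image v).orderEmbOfFin hcard p = v q := hp
  have h1 := congrFun hx p
  rw [Matrix.mulVec, dotProduct, Finset.sum_eq_single q] at h1
  · simpa [hp', hv] using h1
  · intro q' _ hq'
    rw [Matrix.of_apply, hp', if_neg, zero_mul]
    exact fun h => hq' (hA _ _ _ h (hv q))
  · simp

/-- The linear functional on the Koszul complex in multidegree `a` that pairs a chain with the
cochain `incidenceDet k A`. -/
noncomputable def incidencePairing {r : ℕ} (A : Fin r → Fin n →₀ ℕ) (a : Fin n →₀ ℕ)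
    (f : Finset (Fin n) → MvPolynomial (Fin n) k) : k :=
  ∑ U, incidenceDet k A U *
    if ∀ u ∈ U, a u ≠ 0 then (f U).coeff (a - squarefreeExponent U) else 0

theorem incidencePairing_sub {r : ℕ} (A : Fin r → Fin n →₀ ℕ) (a : Fin n →₀ ℕ)
    (f g : Finset (Fin n) → MvPolynomial (Fin n) k) :
    incidencePairing A a (f - g) = incidencePairing A a f - incidencePairing A a g := by
  rw [incidencePairing, incidencePairing, incidencePairing, ← Finset.sum_sub_distrib]
  refine Finset.sum_congr rfl fun U _ => ?_
  split_ifs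
  · rw [Pi.sub_apply, coeff_sub, mul_sub]
  · simp

theorem incidencePairing_koszulDiff {r : ℕ} {A : Fin r → Fin n →₀ ℕ}
    (hA : ∀ i j v, A i v ≠ 0 → A j v ≠ 0 → i = j) {a : Fin n →₀ ℕ}
    (ha : ∀ w, a w ≠ 0 → ∃ i, A i w ≠ 0)
    (h : Finset (Fin n) → MvPolynomial (Fin n) k) :
    incidencePairing A a (koszulDiff k h) = 0 := by
  classical
  -- The guard makes the truncated difference a genuine one, so ψ picks out the part of h in
  -- multidegree a.
  set ψ : Finset (Fin n) → k := fun W =>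
    if ∀ u ∈ W, a u ≠ 0 then (h W).coeff (a - squarefreeExponent W) else 0
  have h1 : ∀ U, (if ∀ u ∈ U, a u ≠ 0 then (koszulDiff k h U).coeff (a - squarefreeExponent U)
      else 0) = ∑ t ∈ Uᶜ, (koszulSign U t : k) * ψ (insert t U) := by
    intro U
    split_ifs with hU
    · rw [coeff_koszulDiff]
      refine Finset.sum_congr rfl fun t ht => ?_
      have htU : t ∉ U := by simpa using ht
      have hat : (a - squarefreeExponent U : Fin n →₀ ℕ) t = a t := by
        rw [Finsupp.tsub_apply, squarefreeExponent_apply, if_neg htU, tsub_zero]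
      rw [hat]
      simp only [ψ, Finset.forall_mem_insert, and_iff_left hU]
      rw [squarefreeExponent_insert htU, add_comm, tsub_add_eq_tsub_tsub]
    · refine (Finset.sum_eq_zero fun t ht => ?_).symm
      simp only [ψ]
      rw [if_neg fun h => hU fun u hu => h u (Finset.mem_insert_of_mem hu), mul_zero]
  have h2 : incidencePairing A a (koszulDiff k h) = ∑ W, ψ W * ∑ t ∈ W,
      (koszulSign (W.erase t) t : k) * incidenceDet k A (W.erase t) := by
    simp only [incidencePairing, h1, Finset.mul_sum]
    rw [Finset.sum_sigma', Finset.sum_sigma']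
    -- Summation by parts, with W = U ∪ {t}, moves the differential onto the cochain.
    refine Finset.sum_bij' (fun p _ => ⟨insert p.2 p.1, p.2⟩) (fun p _ => ⟨p.1.erase p.2, p.2⟩)
      ?_ ?_ ?_ ?_ ?_
    · rintro ⟨U, t⟩ -
      simp
    · rintro ⟨W, t⟩ -
      simp
    · rintro ⟨U, t⟩ ht
      have : t ∉ U := by simpa using ht
      simp [this]
    · rintro ⟨W, t⟩ ht
      have : t ∈ W := by simpa using ht
      simp [this]
    · rintro ⟨U, t⟩ ht
      have : t ∉ U := by simpa using ht
      simp only [Finset.erase_insert this]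
      ring
  rw [h2]
  refine Finset.sum_eq_zero fun W _ => ?_
  by_cases hW : ∀ u ∈ W, a u ≠ 0
  · rw [sum_koszulSign_mul_incidenceDet hA fun w hw => ha w (hW w hw), mul_zero]
  · simp only [ψ]
    rw [if_neg hW, zero_mul]

theorem sum_exponents_apply {r : ℕ} {A : Fin r → Fin n →₀ ℕ}
    (hA : ∀ i j v, A i v ≠ 0 → A j v ≠ 0 → i = j) {i : Fin r} {w : Fin n} (hi : A i w ≠ 0) :
    (∑ i, A i) w = A i w := by
  rw [Finsupp.finsetSum_apply, Finset.sum_eq_single i]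
  · intro j _ hj
    by_contra hjw
    exact hj (hA _ _ _ hjw hi)
  · simp

/-- On block i the multidegree ∑ A_p equals A_i. If x^{A_i} divides x^{∑ A_p - 1_U}, then U misses
block i, and the incidence matrix of U has a zero column. -/
theorem incidencePairing_eq_zero_of_mem {r : ℕ} {A : Fin r → Fin n →₀ ℕ}
    (hA : ∀ i j v, A i v ≠ 0 → A j v ≠ 0 → i = j) {g : Finset (Fin n) → MvPolynomial (Fin n) k}
    (hg : ∀ U, g U ∈ monomialSpan k A) : incidencePairing A (∑ i, A i) g = 0 := by
  classical
  refine Finset.sum_eq_zero fun U _ => ?_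
  by_contra hne
  have h1 := left_ne_zero_of_mul hne
  have h2 := right_ne_zero_of_mul hne
  have h3 : (g U).coeff (∑ i, A i - squarefreeExponent U) ≠ 0 := fun h => h2 (by simp [h])
  obtain ⟨i, hi⟩ := monomial_mem_monomialSpan.1
    ((isMonomialIdeal_monomialSpan A).mem_iff.1 (hg U) _ h3)
  refine h1 ?_
  rw [incidenceDet]
  split_ifs with hU
  · refine Matrix.det_eq_zero_of_column_eq_zero i fun p => ?_
    rw [Matrix.of_apply, if_neg]
    intro hp
    have := hi (U.orderEmbOfFin hU p)
    rw [Finsupp.tsub_apply, sum_exponents_apply hA hp, squarefreeExponent_apply,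
      if_pos (Finset.orderEmbOfFin_mem _ _ _)] at this
    omega
  · rfl

theorem gradedBetti_monomialSpan_ne_zero {m : ℕ} {A : Fin (m + 1) → Fin n →₀ ℕ}
    (hA : ∀ i j v, A i v ≠ 0 → A j v ≠ 0 → i = j) (hA0 : ∀ i, A i ≠ 0) :
    gradedBetti n (idealGrading (monomialSpan k A)) m ((∑ i, A i).degree : ℕ) ≠ 0 := by
  classical
  have hex : ∀ i, ∃ v, A i v ≠ 0 := fun i => by
    by_contra! h
    exact hA0 i (Finsupp.ext h)
  choose v hv using hex
  have hinj : Function.Injective v := fun p q h => hA p q (v p) (hv p) (h ▸ hv q)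
  set V := Finset.univ.image v with hVdef
  have hcard : V.card = m + 1 := by
    rw [hVdef, Finset.card_image_of_injective _ hinj, Finset.card_univ, Fintype.card_fin]
  set a := ∑ i, A i with ha
  have hav : ∀ u ∈ V, a u ≠ 0 := by
    intro u hu
    obtain ⟨q, -, rfl⟩ := Finset.mem_image.1 hu
    rw [ha, sum_exponents_apply hA (hv q)]
    exact hv q
  have hVa : squarefreeExponent V ≤ a := fun u => by
    rw [squarefreeExponent_apply]
    split_ifs with hu
    · exact Nat.one_le_iff_ne_zero.2 (hav u hu)
    · exact Nat.zero_le _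
  have hVne : V ≠ ∅ := fun h => by simp [h] at hcard
  -- In its boundary each term regains one x_{v q}, and with it the full factor x^{A_q}.
  set s : Finset (Fin n) → MvPolynomial (Fin n) k :=
    Pi.single V (monomial (a - squarefreeExponent V) 1) with hs
  have hds : ∀ T, koszulDiff k s T = ∑ t ∈ Tᶜ, if insert t T = V then koszulSign T t •
      monomial (Finsupp.single t 1 + (a - squarefreeExponent V)) (1 : k) else 0 := by
    intro T
    rw [koszulDiff_apply]
    refine Finset.sum_congr rfl fun t _ => ?_
    split_ifs with h
    · rw [hs, h, Pi.single_eq_same, smul_eq_mul, X, monomial_mul, one_mul]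
    · rw [hs, Pi.single_eq_of_ne h, smul_zero, smul_zero]
  refine gradedBetti_idealGrading_ne_zero_iff.2
    ⟨koszulDiff k s, ⟨fun T => ?_, fun T hT b hb => ?_, fun T hT => ?_⟩, koszulDiff_comp_self s, ?_⟩
  · rw [hds]
    refine Ideal.sum_mem _ fun t ht => ?_
    split_ifs with h
    · refine zsmul_mem ?_ _
      have htV : t ∈ V := h ▸ Finset.mem_insert_self _ _
      obtain ⟨q, -, rfl⟩ := Finset.mem_image.1 htV
      refine monomial_mem_monomialSpan.2 ⟨q, fun w => ?_⟩
      by_cases hqw : A q w = 0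
      · simp [hqw]
      rw [Finsupp.add_apply, Finsupp.tsub_apply, ha, sum_exponents_apply hA hqw,
        squarefreeExponent_apply, Finsupp.single_apply]
      by_cases hw : w ∈ V
      · obtain ⟨q', -, rfl⟩ := Finset.mem_image.1 hw
        obtain rfl := hA _ _ _ hqw (hv q')
        rw [if_pos rfl, if_pos hw]
        omega
      · rw [if_neg hw]
        omega
    · exact zero_mem _
  · obtain ⟨t, ht, hne⟩ : ∃ t ∈ Tᶜ, coeff b (if insert t T = V then koszulSign T t •
        monomial (Finsupp.single t 1 + (a - squarefreeExponent V)) (1 : k) else 0) ≠ 0 := by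
      by_contra! h0
      rw [hds, coeff_sum, Finset.sum_eq_zero h0] at hb
      exact hb rfl
    split_ifs at hne with h
    · have hb' : Finsupp.single t 1 + (a - squarefreeExponent V) = b := by
        by_contra hbne
        rw [coeff_smul, coeff_monomial, if_neg hbne, smul_zero] at hne
        exact hne rfl
      have hdeg := congrArg Finsupp.degree (tsub_add_cancel_of_le hVa)
      rw [map_add, degree_squarefreeExponent, hcard] at hdeg
      rw [← hb', map_add, Finsupp.degree_single, ← hdeg]
      push_cast
      ring
    · simp at hne
  · rw [hds]
    refine Finset.sum_eq_zero fun t ht => if_neg fun h => hT ?_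
    have : t ∉ T := by simpa using ht
    rw [← h, Finset.card_insert_of_notMem this] at hcard
    omega
  · rintro ⟨g, hg, hgs⟩
    -- If g over I has the same boundary as s, then g - s is a cycle over the whole ring, hence a
    -- boundary. The pairing kills g - s and g, but not s.
    obtain ⟨h, hh⟩ := (koszulDiff_exact (g - s)).2 ⟨by rw [map_sub, hgs, sub_self], by
      rw [Pi.sub_apply, hg.eq_zero ∅ (by simp), hs, Pi.single_eq_of_ne hVne.symm, sub_zero,
        map_zero]⟩
    have h1 := incidencePairing_koszulDiff (k := k) (A := A) (a := a) hA (fun w hw => by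
      by_contra! h0
      exact hw (by rw [ha, Finsupp.finsetSum_apply]; exact Finset.sum_eq_zero fun i _ => h0 i)) h
    rw [hh, incidencePairing_sub, incidencePairing_eq_zero_of_mem hA hg.mem, zero_sub,
      neg_eq_zero, incidencePairing, Finset.sum_eq_single V] at h1
    · rw [if_pos hav, hs, Pi.single_eq_same, coeff_monomial, if_pos rfl, mul_one] at h1
      exact incidenceDet_ne_zero hA hv h1
    · intro U _ hU
      rw [hs, Pi.single_eq_of_ne hU, coeff_zero, ite_self, mul_zero]
    · simp

end LowerBound

/-! ### Comparison of the two regularities -/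

theorem theorem4p3 {k : Type*} [Field k] {n : ℕ} (I : Ideal (MvPolynomial (Fin n) k))
    (hI : IsMonomialCompleteIntersection I) (hI0 : I ≠ ⊥) :
    ∃ r s : ℤ, HasRegularity (idealIntegralClosure I) r ∧ HasRegularity I s ∧ r ≤ s := by
  obtain ⟨m, A, hA0, hA, rfl⟩ := exists_exponents_of_isMonomialCompleteIntersection hI hI0
  have hle := le_idealIntegralClosure (monomialSpan k A)
  have hJ := isMonomialIdeal_idealIntegralClosure (k := k) A
  have hbound : ∀ r ∈ regularitySet n (idealGrading (idealIntegralClosure (monomialSpan k A))),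
      r ≤ (∑ p, ((A p).degree : ℤ)) - Fintype.card (Fin (m + 1)) + 1 := by
    rintro _ ⟨i, j, h, rfl⟩
    exact regularity_le_of_gradedBetti_ne_zero hA hA0 hle hJ (lowerableAlong_idealIntegralClosure hA) h
  obtain ⟨r, hr⟩ := exists_hasRegularity hJ (fun h => hI0 (le_bot_iff.1 (h ▸ hle))) hbound
  -- The regularity of I is deg(∑ A_p) - m, which is the common upper bound because there are m + 1
  -- generators.
  refine ⟨r, _, hr, ⟨⟨m, _, gradedBetti_monomialSpan_ne_zero hA hA0, rfl⟩, ?_⟩, ?_⟩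
  · rintro _ ⟨i, j, h, rfl⟩
    refine (regularity_le_of_gradedBetti_ne_zero hA hA0 le_rfl (isMonomialIdeal_monomialSpan A)
      lowerableAlong_monomialSpan h).trans_eq ?_
    rw [map_sum, Fintype.card_fin]
    push_cast
    ring
  · refine (hbound r hr.1).trans_eq ?_
    rw [map_sum, Fintype.card_fin]
    push_cast
    ring
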